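/- Let $\alpha,\beta>0$. There is a constant $C>0$, depending only on $\alpha$ and $\beta$, such that the following holds. Let $\mathcal D$ be a probability distribution supported on $[0,1]$ that has a density $f$ with $\alpha\le f(x)\le\beta$ for all $x\in[0,1]$. Let $m$ items be allocated among $n$ agents $1,\dots,n$, where $m=rn+q$ with integers $r\ge 0$ and $1\le q<n$, and let the utilities $u_i(j)$ of agent $i$ for item $j$ $(1\le i\le n,\ 1\le j\le m)$ be independent random variables with distribution $\mathcal D$; for a set $S$ of items put $u_i(S)=\sum_{j\in S}u_i(j)$. In the *round-robin algorithm with reversed last round*, the agents take turns, each picking his or her most preferred item among the remaining ones (ties, which have probability $0$, are broken in favour of the smallest index): in each of the first $r$ rounds the agents pick in the order $1,2,\dots,n$, and in the final round the agents $n,n-1,\dots,n-q+1$ pick in this order. Let $M_i$ be the set of items picked by agent $i$. Then, with probability at least $1-C/\sqrt q$, $(M_1,\dots,M_n)$ is a partition of the items and is envy-free up to any item (EFX), i.e. $$u_i(M_i)\ \ge\ u_i(M_{i'}\setminus\{j\})\qquad\text{for all agents } i,i' \text{ and all } j\in M_{i'}.$$ -/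

import Mathlib

open MeasureTheory ProbabilityTheory

/-- A distribution `D` on the real line is `(α, β)`-PDF-bounded: it is supported on `[0, 1]` and has
a density `f` with respect to Lebesgue measure such that `α ≤ f x ≤ β` for all `x ∈ [0, 1]`.
(Having a density, `D` is non-atomic.) -/
def IsPDFBounded (α β : ℝ) (D : Measure ℝ) : Prop :=
  ∃ f : ℝ → ℝ, Measurable f ∧ (∀ x ∈ Set.Icc (0 : ℝ) 1, α ≤ f x ∧ f x ≤ β) ∧
    D = (volume.restrict (Set.Icc (0 : ℝ) 1)).withDensity (fun x => ENNReal.ofReal (f x))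

/-- The bundles `A i`, for the agents `i`, form a partition of the set of all items (bundles may be
empty). -/
def IsAllocation {n m : ℕ} (A : Fin n → Finset (Fin m)) : Prop :=
  ∀ j : Fin m, ∃! i : Fin n, j ∈ A i

/-- Envy-freeness up to any item, for the additive utilities with item values `u i j`. -/
def IsEFX {n m : ℕ} (u : Fin n → Fin m → ℝ) (A : Fin n → Finset (Fin m)) : Prop :=
  ∀ i i' : Fin n, ∀ j ∈ A i', ∑ k ∈ (A i').erase j, u i k ≤ ∑ k ∈ A i, u i k

open Classical in
/-- The most preferred items in `S` for an agent whose item values are `v`. -/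
noncomputable def mostPreferred {m : ℕ} (v : Fin m → ℝ) (S : Finset (Fin m)) : Finset (Fin m) :=
  S.filter (fun j => ∀ k ∈ S, v k ≤ v j)

open Classical in
/-- Sequential picking. The agents in the list take turns in that order; each picks a most preferred
item among the remaining items `S` (the one of smallest index if there is a tie) and adds it to the
bundle held so far. The process stops when there is nothing left to pick. -/
noncomputable def sequentialPicks {n m : ℕ} (u : Fin n → Fin m → ℝ) :
    List (Fin n) → Finset (Fin m) → (Fin n → Finset (Fin m)) → (Fin n → Finset (Fin m))
  | [], _, A => A
  | i :: order, S, A =>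
    if h : (mostPreferred (u i) S).Nonempty then
      sequentialPicks u order (S.erase ((mostPreferred (u i) S).min' h))
        (Function.update A i (insert ((mostPreferred (u i) S).min' h) (A i)))
    else A

/-- With `r = m / n` and `q = m % n`: first `r` rounds in the order `1, 2, …, n`, then a last round
in the order `n, n - 1, …, n - q + 1`. (The agents are numbered from `0` in `Fin n`.) -/
def reversedLastRoundOrder (n m : ℕ) : List (Fin n) :=
  (List.replicate (m / n) (List.finRange n)).flatten ++ (List.finRange n).reverse.take (m % n)

/-- The output of the round-robin algorithm with reversed last round. -/
noncomputable def roundRobinReversedLast {n m : ℕ} (u : Fin n → Fin m → ℝ) :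
    Fin n → Finset (Fin m) :=
  sequentialPicks u (reversedLastRoundOrder n m) Finset.univ (fun _ => ∅)

/-! Let δ = q^(-1/4). If i < i', agent i picks before i' in every regular round, and a pick of i' in
the reversed round is worth to i at most any regular pick of i; so i does not envy i' after any
deletion (`sum_erase_le_of_lead`). If i' < i, then i has at least as many turns and trails by one
round: its pick t is worth to it at least pick t + 1 of i'. Only the first pick of i', worth at most
1, is left to compensate (`sum_erase_le_of_lag`). This succeeds if the regular picks of i are worth
at least 1 - δ and a needed last pick at least δ, or if two of the gaps between pick t of i and pick
t + 1 of i' are at least 1/2.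

For the probabilities, fix the run before a turn and all values except those which agent i gives to
the remaining items. The latter are then independent with law D conditioned to lie below the last
pick of i, because resampling them there leaves the run unchanged. `pi_le_pow_mul_of_sections`
expresses this without conditional measures. With k items left, a drop by d from one pick of i to
the next thus has probability at most (1 - αd)^k. Moreover, an item taken by another agent is worth
at most 1/4 to i with conditional probability at least α/4.

Put h = ⌈n^(1/4)⌉. If r ≤ 2h, the drops over all regular rounds probably add up to at most δ. If r >
2h, the picks of i in the first 2h rounds probably stay above 3/4, while each of two blocks of h
picks of i' probably contains one worth at most 1/4 to i; this gives the two gaps.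

The rate comes from the reversed round: an agent who finds k items there fails with probability
O(δ)^k. The final picker, with k = 1, needs no bound, since no agent with a smaller number has an
extra item. Hence k ≥ 2, and the total is O(δ²) = O(1/√q). -/

/-! ### The run of a sequential picking process -/

/-- The item which an agent with item values `v` picks when the items in `S` are available. -/
noncomputable def favourite {m : ℕ} [NeZero m] (v : Fin m → ℝ) (S : Finset (Fin m)) : Fin m :=
  if h : (mostPreferred v S).Nonempty then (mostPreferred v S).min' h else 0

theorem mem_mostPreferred {m : ℕ} {v : Fin m → ℝ} {S : Finset (Fin m)} {b : Fin m} :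
    b ∈ mostPreferred v S ↔ b ∈ S ∧ ∀ k ∈ S, v k ≤ v b := by
  simp [mostPreferred]

theorem mostPreferred_nonempty {m : ℕ} (v : Fin m → ℝ) {S : Finset (Fin m)} (hS : S.Nonempty) :
    (mostPreferred v S).Nonempty := by
  obtain ⟨b, hb, hmax⟩ := S.exists_max_image v hS
  exact ⟨b, mem_mostPreferred.2 ⟨hb, hmax⟩⟩

theorem favourite_mem_mostPreferred {m : ℕ} [NeZero m] (v : Fin m → ℝ) {S : Finset (Fin m)}
    (hS : S.Nonempty) : favourite v S ∈ mostPreferred v S := by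
  rw [favourite, dif_pos (mostPreferred_nonempty v hS)]
  exact Finset.min'_mem _ _

theorem favourite_mem {m : ℕ} [NeZero m] (v : Fin m → ℝ) {S : Finset (Fin m)}
    (hS : S.Nonempty) : favourite v S ∈ S :=
  (mem_mostPreferred.1 (favourite_mem_mostPreferred v hS)).1

theorem le_favourite {m : ℕ} [NeZero m] (v : Fin m → ℝ) {S : Finset (Fin m)} {c : Fin m}
    (hc : c ∈ S) : v c ≤ v (favourite v S) :=
  (mem_mostPreferred.1 (favourite_mem_mostPreferred v ⟨c, hc⟩)).2 c hc

theorem favourite_le {m : ℕ} [NeZero m] (v : Fin m → ℝ) {S : Finset (Fin m)} {a : Fin m}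
    (ha : a ∈ mostPreferred v S) : favourite v S ≤ a := by
  rw [favourite, dif_pos ⟨a, ha⟩]
  exact Finset.min'_le _ _ ha

/-- Changing the values of items other than the favourite, but keeping them below the value of the
favourite, does not change the favourite. -/
theorem favourite_congr_of_lt {m : ℕ} [NeZero m] {v w : Fin m → ℝ} {S T : Finset (Fin m)}
    (hS : S.Nonempty) (hT : favourite v S ∉ T) (hvw : ∀ c ∉ T, w c = v c)
    (hlt : ∀ c ∈ T, w c < v (favourite v S)) : favourite w S = favourite v S := by
  set b := favourite v S with hb
  have hbS : b ∈ S := favourite_mem v hS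
  have hwb : w b = v b := hvw b hT
  have hbw : b ∈ mostPreferred w S := by
    refine mem_mostPreferred.2 ⟨hbS, fun k hk => ?_⟩
    by_cases hkT : k ∈ T
    · rw [hwb]; exact (hlt k hkT).le
    · rw [hwb, hvw k hkT]; exact le_favourite v hk
  -- Ties require both inequalities: the old favourite still maximises `w`, and the new favourite,
  -- which lies outside `T`, already maximised `v`.
  refine le_antisymm (favourite_le w hbw) ?_
  obtain ⟨haS, hamax⟩ := mem_mostPreferred.1 (favourite_mem_mostPreferred w hS)
  set a := favourite w S
  have haT : a ∉ T := fun h => by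
    have h1 := hamax b hbS
    have h2 := hlt a h
    linarith
  refine favourite_le v (mem_mostPreferred.2 ⟨haS, fun k hk => ?_⟩)
  have h1 := hamax b hbS
  rw [hwb, hvw a haT] at h1
  exact (le_favourite v hk).trans h1

/-- The items which are left after `k` turns, when agent `σ j` takes the turn number `j`. -/
noncomputable def remaining {n m : ℕ} [NeZero m] (σ : ℕ → Fin n) (u : Fin n → Fin m → ℝ) :
    ℕ → Finset (Fin m)
  | 0 => Finset.univ
  | k + 1 => (remaining σ u k).erase (favourite (u (σ k)) (remaining σ u k))

/-- The item which is picked in the turn number `k`. -/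
noncomputable def picked {n m : ℕ} [NeZero m] (σ : ℕ → Fin n) (u : Fin n → Fin m → ℝ) (k : ℕ) :
    Fin m :=
  favourite (u (σ k)) (remaining σ u k)

section Run

variable {n m : ℕ} [NeZero m] (σ : ℕ → Fin n) (u : Fin n → Fin m → ℝ)

theorem remaining_succ (k : ℕ) :
    remaining σ u (k + 1) = (remaining σ u k).erase (picked σ u k) := rfl

theorem card_remaining {k : ℕ} (hk : k ≤ m) : (remaining σ u k).card = m - k := by
  induction k with
  | zero => simp [remaining]
  | succ k ih =>
    have h := ih (by omega)
    have hne : (remaining σ u k).Nonempty := Finset.card_pos.1 (by omega)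
    rw [remaining_succ,
      Finset.card_erase_of_mem (show picked σ u k ∈ _ from favourite_mem _ hne), h]
    omega

theorem remaining_nonempty {k : ℕ} (hk : k < m) : (remaining σ u k).Nonempty :=
  Finset.card_pos.1 (by rw [card_remaining σ u hk.le]; omega)

theorem remaining_antitone : Antitone (remaining σ u) :=
  antitone_nat_of_succ_le fun _ => Finset.erase_subset _ _

theorem picked_mem {k : ℕ} (hk : k < m) : picked σ u k ∈ remaining σ u k :=
  favourite_mem _ (remaining_nonempty σ u hk)

theorem picked_notMem {k l : ℕ} (hkl : k < l) : picked σ u k ∉ remaining σ u l := fun h =>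
  Finset.notMem_erase _ _ (remaining_antitone σ u (Nat.succ_le_of_lt hkl) h)

theorem le_picked {k : ℕ} {c : Fin m} (hc : c ∈ remaining σ u k) :
    u (σ k) c ≤ u (σ k) (picked σ u k) :=
  le_favourite _ hc

theorem picked_le_picked {k l : ℕ} (hkl : k ≤ l) (hl : l < m) :
    u (σ k) (picked σ u l) ≤ u (σ k) (picked σ u k) :=
  le_picked σ u (remaining_antitone σ u hkl (picked_mem σ u hl))

theorem picked_injOn : Set.InjOn (picked σ u) (Set.Iio m) := by
  intro k hk l hl hkl
  by_contra hne
  rcases lt_or_gt_of_ne hne with h | h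
  · exact picked_notMem σ u h (hkl ▸ picked_mem σ u hl)
  · exact picked_notMem σ u h (hkl ▸ picked_mem σ u hk)

theorem exists_picked_eq (j : Fin m) : ∃ k < m, picked σ u k = j := by
  have h : (Finset.range m).image (picked σ u) = Finset.univ := by
    rw [← Finset.card_eq_iff_eq_univ, Finset.card_image_of_injOn]
    · simp
    · simpa using picked_injOn σ u
  obtain ⟨k, hk, hkj⟩ := Finset.mem_image.1 (h ▸ Finset.mem_univ j)
  exact ⟨k, Finset.mem_range.1 hk, hkj⟩

/-- Changing the values which one agent assigns to items that have not been picked before turn `s`,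
but keeping them below the values of the items that this agent has picked before, does not change
the run up to turn `s`. -/
theorem remaining_congr {u u' : Fin n → Fin m → ℝ} {i : Fin n} {T : Finset (Fin m)} {s : ℕ}
    (hs : s ≤ m) (hT : T ⊆ remaining σ u s) (heq : ∀ j c, (j = i → c ∉ T) → u' j c = u j c)
    (hlt : ∀ k < s, σ k = i → ∀ c ∈ T, u' i c < u i (picked σ u k)) {k : ℕ} (hk : k ≤ s) :
    remaining σ u' k = remaining σ u k := by
  induction k with
  | zero => rfl
  | succ k ih =>
    have ih := ih (by omega)
    have hpick : picked σ u' k = picked σ u k := by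
      rw [picked, picked, ih]
      by_cases hi : σ k = i
      · subst hi
        refine favourite_congr_of_lt (T := T) (remaining_nonempty σ u (by omega)) ?_
          (fun c hc => heq _ _ fun _ => hc) (hlt k (by omega) rfl)
        exact fun h => picked_notMem σ u (show k < s by omega) (hT h)
      · congr 1
        funext c
        exact heq _ _ fun h => absurd h hi
    rw [remaining_succ, remaining_succ, ih, hpick]

theorem picked_congr_of_lt {u u' : Fin n → Fin m → ℝ} {i : Fin n} {T : Finset (Fin m)} {s : ℕ}
    (hs : s ≤ m) (hT : T ⊆ remaining σ u s) (heq : ∀ j c, (j = i → c ∉ T) → u' j c = u j c)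
    (hlt : ∀ k < s, σ k = i → ∀ c ∈ T, u' i c < u i (picked σ u k)) {k : ℕ} (hk : k < s) :
    picked σ u' k = picked σ u k := by
  have h0 := remaining_congr σ hs hT heq hlt hk.le
  have h1 := remaining_congr σ hs hT heq hlt (Nat.succ_le_of_lt hk)
  have hm := picked_mem σ u' (show k < m by omega)
  by_contra hne
  have : picked σ u' k ∈ remaining σ u (k + 1) := by
    rw [remaining_succ]
    exact Finset.mem_erase.2 ⟨hne, h0 ▸ hm⟩
  rw [← h1] at this
  exact picked_notMem σ u' (Nat.lt_succ_self k) this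

theorem sequentialPicks_map (len k : ℕ) (A : Fin n → Finset (Fin m)) (h : k + len ≤ m) :
    sequentialPicks u ((List.range' k len).map σ) (remaining σ u k) A =
      fun i => A i ∪ ((Finset.Ico k (k + len)).filter (fun l => σ l = i)).image (picked σ u) := by
  induction len generalizing k A with
  | zero => funext i; simp [sequentialPicks]
  | succ len ih =>
    have hne := mostPreferred_nonempty (u (σ k)) (remaining_nonempty σ u (show k < m by omega))
    have hpick : (mostPreferred (u (σ k)) (remaining σ u k)).min' hne = picked σ u k := by
      rw [picked, favourite, dif_pos hne]
    rw [List.range'_succ, List.map_cons, sequentialPicks, dif_pos hne, hpick, ← remaining_succ,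
      ih (k + 1) _ (by omega)]
    funext i
    have hIco : Finset.Ico k (k + (len + 1)) = insert k (Finset.Ico (k + 1) (k + 1 + len)) := by
      ext a; simp only [Finset.mem_Ico, Finset.mem_insert]; omega
    rw [hIco, Finset.filter_insert]
    by_cases hi : σ k = i
    · subst hi
      rw [if_pos rfl, Function.update_self, Finset.image_insert]
      ext a; simp only [Finset.mem_union, Finset.mem_insert]; tauto
    · rw [if_neg hi, Function.update_of_ne (Ne.symm hi)]

end Run

/-! ### Round-robin with reversed last round -/

/-- The agent who takes turn number `k` in round-robin with `r` rounds and a reversed last round. -/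
def turn (n r : ℕ) [NeZero n] (k : ℕ) : Fin n :=
  if k < r * n then Fin.ofNat n k else (Fin.ofNat n (k - r * n)).rev

theorem turn_of_lt {n r k : ℕ} [NeZero n] (h : k < r * n) : (turn n r k : ℕ) = k % n := by
  simp [turn, h, Fin.ofNat]

theorem turn_of_ge {n r k : ℕ} [NeZero n] (h : r * n ≤ k) (h' : k - r * n < n) :
    (turn n r k : ℕ) = n - 1 - (k - r * n) := by
  rw [turn, if_neg (by omega), Fin.val_rev]
  simp [Fin.ofNat, Nat.mod_eq_of_lt h']
  omega

theorem reversedLastRoundOrder_eq {n r q : ℕ} [NeZero n] (hq : q < n) :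
    reversedLastRoundOrder n (r * n + q) = (List.range (r * n + q)).map (turn n r) := by
  have hn : 0 < n := by omega
  have hdiv : (r * n + q) / n = r := by
    rw [Nat.add_div_of_dvd_right (Dvd.intro_left r rfl), Nat.mul_div_cancel _ hn,
      Nat.div_eq_of_lt hq, add_zero]
  have hmod : (r * n + q) % n = q := by
    rw [Nat.add_mod, Nat.mul_mod_left, zero_add, Nat.mod_mod, Nat.mod_eq_of_lt hq]
  rw [reversedLastRoundOrder, hdiv, hmod, List.range_add, List.map_append]
  congr 1
  · have key : ∀ s : ℕ, (List.replicate s (List.finRange n)).flatten =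
        (List.range (s * n)).map (Fin.ofNat n) := by
      intro s
      induction s with
      | zero => simp
      | succ s ih =>
        rw [List.replicate_succ', List.flatten_append, ih, Nat.succ_mul, List.range_add,
          List.map_append]
        congr 1
        apply List.ext_getElem
        · simp
        · intro k h1 h2
          apply Fin.ext
          simp at h1
          simp [Fin.ofNat, Nat.mod_eq_of_lt h1]
    rw [key]
    refine List.map_congr_left fun k hk => ?_
    rw [turn, if_pos (List.mem_range.1 hk)]
  · apply List.ext_getElem
    · simp; omega
    · intro k h1 h2
      simp at h1
      apply Fin.ext
      have := turn_of_ge (n := n) (r := r) (k := r * n + k) (by omega) (by omega)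
      simp [this]

theorem roundRobinReversedLast_eq {n r q : ℕ} [NeZero n] [NeZero (r * n + q)] (hq : q < n)
    (u : Fin n → Fin (r * n + q) → ℝ) (i : Fin n) :
    roundRobinReversedLast u i =
      ((Finset.range (r * n + q)).filter (fun l => turn n r l = i)).image
        (picked (turn n r) u) := by
  have h := sequentialPicks_map (turn n r) u (r * n + q) 0 (fun _ => ∅) (by omega)
  rw [← List.range_eq_range', ← reversedLastRoundOrder_eq hq] at h
  rw [roundRobinReversedLast]
  have hi := congrFun h i
  rw [Finset.empty_union, zero_add, ← Finset.range_eq_Ico] at hi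
  exact hi

theorem isAllocation_roundRobinReversedLast {n r q : ℕ} [NeZero n] [NeZero (r * n + q)]
    (hq : q < n) (u : Fin n → Fin (r * n + q) → ℝ) : IsAllocation (roundRobinReversedLast u) := by
  intro j
  obtain ⟨k, hk, hkj⟩ := exists_picked_eq (turn n r) u j
  refine ⟨turn n r k, ?_, fun i hi => ?_⟩
  · simp only [roundRobinReversedLast_eq hq]
    exact Finset.mem_image.2 ⟨k, by simp [hk], hkj⟩
  · simp only [roundRobinReversedLast_eq hq] at hi
    obtain ⟨l, hl, hlj⟩ := Finset.mem_image.1 hi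
    simp only [Finset.mem_filter, Finset.mem_range] at hl
    rw [← hl.2, picked_injOn (turn n r) u hl.1 hk (hlj.trans hkj.symm)]

/-! ### Turns and picks indexed by agent and round -/

/-- The number of the turn in which agent `i` picks for the time number `t`. -/
def turnOf (n r : ℕ) (i : Fin n) (t : ℕ) : ℕ :=
  if t < r then t * n + i else r * n + (n - 1 - i)

/-- How many items agent `i` picks. -/
def numTurns (n r q : ℕ) (i : Fin n) : ℕ := if n - q ≤ i then r + 1 else r

theorem turnOf_of_lt {n r t : ℕ} (i : Fin n) (ht : t < r) : turnOf n r i t = t * n + i :=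
  if_pos ht

theorem turnOf_self {n r : ℕ} (i : Fin n) : turnOf n r i r = r * n + (n - 1 - i) :=
  if_neg (lt_irrefl r)

theorem mul_add_lt_mul {n r t a : ℕ} (ht : t < r) (ha : a < n) : t * n + a < r * n := by
  calc t * n + a < t * n + n := by omega
    _ = (t + 1) * n := by ring
    _ ≤ r * n := Nat.mul_le_mul_right n ht

theorem turnOf_lt_of_lt {n r t t' : ℕ} (i i' : Fin n) (h : t < t') (ht : t < r) :
    turnOf n r i t < turnOf n r i' t' := by
  rw [turnOf_of_lt i ht, turnOf]
  split_ifs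
  · exact (mul_add_lt_mul h i.2).trans_le (Nat.le_add_right _ _)
  · exact (mul_add_lt_mul ht i.2).trans_le (Nat.le_add_right _ _)

theorem numTurns_le {n r q : ℕ} (i : Fin n) : numTurns n r q i ≤ r + 1 := by
  unfold numTurns; split_ifs <;> omega

theorem le_numTurns {n r q : ℕ} (i : Fin n) : r ≤ numTurns n r q i := by
  unfold numTurns; split_ifs <;> omega

theorem numTurns_mono {n r q : ℕ} {i i' : Fin n} (h : i ≤ i') :
    numTurns n r q i ≤ numTurns n r q i' := by
  have : (i : ℕ) ≤ i' := h
  unfold numTurns; split_ifs <;> omega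

theorem turnOf_lt {n r q t : ℕ} {i : Fin n} (hq : q < n) (ht : t < numTurns n r q i) :
    turnOf n r i t < r * n + q := by
  rw [turnOf]
  have := i.2
  split_ifs with h
  · exact (mul_add_lt_mul h i.2).trans_le (Nat.le_add_right _ _)
  · unfold numTurns at ht
    split_ifs at ht <;> omega

theorem turn_turnOf {n r t : ℕ} [NeZero n] {i : Fin n} :
    turn n r (turnOf n r i t) = i := by
  apply Fin.ext
  have hi := i.2
  rw [turnOf]
  split_ifs with h
  · rw [turn_of_lt (mul_add_lt_mul h i.2), Nat.add_mod, Nat.mul_mod_left, zero_add, Nat.mod_mod,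
      Nat.mod_eq_of_lt i.2]
  · rw [turn_of_ge (by omega) (by omega)]
    omega

theorem exists_turnOf_eq {n r q k : ℕ} [NeZero n] (hq : q < n) (hk : k < r * n + q) :
    ∃ t < numTurns n r q (turn n r k), turnOf n r (turn n r k) t = k := by
  have hn : 0 < n := by omega
  by_cases h : k < r * n
  · have hdiv : k / n < r := (Nat.div_lt_iff_lt_mul hn).2 h
    refine ⟨k / n, hdiv.trans_le (le_numTurns _), ?_⟩
    rw [turnOf_of_lt _ hdiv, turn_of_lt h, mul_comm]
    exact Nat.div_add_mod k n
  · have h1 := turn_of_ge (n := n) (r := r) (k := k) (by omega) (by omega)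
    refine ⟨r, ?_, ?_⟩
    · unfold numTurns
      rw [if_pos (by omega)]
      omega
    · rw [turnOf_self]
      omega

theorem turnOf_injOn {n r q : ℕ} (i : Fin n) :
    Set.InjOn (turnOf n r i) (Finset.range (numTurns n r q i)) := by
  intro t ht t' ht' h
  simp only [Finset.coe_range, Set.mem_Iio] at ht ht'
  have := numTurns_le (r := r) (q := q) i
  by_contra hne
  rcases lt_or_gt_of_ne hne with hlt | hlt
  · exact (turnOf_lt_of_lt i i hlt (by omega)).ne h
  · exact (turnOf_lt_of_lt i i hlt (by omega)).ne h.symm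

theorem filter_turn_eq {n r q : ℕ} [NeZero n] (hq : q < n) (i : Fin n) :
    (Finset.range (r * n + q)).filter (fun l => turn n r l = i) =
      (Finset.range (numTurns n r q i)).image (turnOf n r i) := by
  ext k
  simp only [Finset.mem_filter, Finset.mem_range, Finset.mem_image]
  constructor
  · rintro ⟨hk, rfl⟩
    exact exists_turnOf_eq hq hk
  · rintro ⟨t, ht, rfl⟩
    exact ⟨turnOf_lt hq ht, turn_turnOf⟩

/-- The item which agent `i` picks for the time number `t`. -/
noncomputable def pickOf {n m : ℕ} [NeZero n] [NeZero m] (r : ℕ) (u : Fin n → Fin m → ℝ)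
    (i : Fin n) (t : ℕ) : Fin m :=
  picked (turn n r) u (turnOf n r i t)

section RoundRobin

variable {n r q : ℕ} [NeZero n] [NeZero (r * n + q)]

theorem roundRobinReversedLast_eq_image (hq : q < n)
    (u : Fin n → Fin (r * n + q) → ℝ) (i : Fin n) :
    roundRobinReversedLast u i = (Finset.range (numTurns n r q i)).image (pickOf r u i) := by
  rw [roundRobinReversedLast_eq hq, filter_turn_eq hq, Finset.image_image]
  rfl

theorem pickOf_injOn (hq : q < n)
    (u : Fin n → Fin (r * n + q) → ℝ) (i : Fin n) :
    Set.InjOn (pickOf r u i) (Finset.range (numTurns n r q i)) := by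
  intro t ht t' ht' h
  refine turnOf_injOn i ht ht' (picked_injOn (turn n r) u ?_ ?_ h)
  · exact turnOf_lt hq (by simpa using ht)
  · exact turnOf_lt hq (by simpa using ht')

theorem sum_roundRobinReversedLast (hq : q < n)
    (u : Fin n → Fin (r * n + q) → ℝ) (v : Fin (r * n + q) → ℝ) (i : Fin n) :
    ∑ k ∈ roundRobinReversedLast u i, v k =
      ∑ t ∈ Finset.range (numTurns n r q i), v (pickOf r u i t) := by
  rw [roundRobinReversedLast_eq_image hq, Finset.sum_image (pickOf_injOn hq u i)]

theorem sum_erase_roundRobinReversedLast (hq : q < n)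
    (u : Fin n → Fin (r * n + q) → ℝ) (v : Fin (r * n + q) → ℝ) (i : Fin n) {s : ℕ}
    (hs : s < numTurns n r q i) :
    ∑ k ∈ (roundRobinReversedLast u i).erase (pickOf r u i s), v k =
      ∑ t ∈ (Finset.range (numTurns n r q i)).erase s, v (pickOf r u i t) := by
  have hmem : pickOf r u i s ∈ roundRobinReversedLast u i := by
    rw [roundRobinReversedLast_eq_image hq]
    exact Finset.mem_image_of_mem _ (Finset.mem_range.2 hs)
  rw [Finset.sum_erase_eq_sub hmem, Finset.sum_erase_eq_sub (Finset.mem_range.2 hs),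
    sum_roundRobinReversedLast hq]

theorem pickOf_le_pickOf (hq : q < n)
    (u : Fin n → Fin (r * n + q) → ℝ) {i i' : Fin n} {t t' : ℕ}
    (ht' : t' < numTurns n r q i') (h : turnOf n r i t ≤ turnOf n r i' t') :
    u i (pickOf r u i' t') ≤ u i (pickOf r u i t) := by
  have := picked_le_picked (turn n r) u h (turnOf_lt hq ht')
  rwa [turn_turnOf] at this

end RoundRobin

/-! ### A deterministic criterion for envy-freeness up to any item -/

/-- Pairing `y t` with `x (t + 1)` leaves `y (R - 1)` against `x 0 ≤ 1`. Deleting `x 0` settles the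
matter at once. Deleting `x (s + 1)` frees the whole of `y s`, which together with `y (R - 1)`
covers `x 0` in the first alternative; in the second, two gaps of 1/2 cover it. -/
theorem sum_erase_le_of_lag {x y : ℕ → ℝ} {R s : ℕ} (hs : s < R) (hy : ∀ t < R, 0 ≤ y t)
    (hx0 : x 0 ≤ 1) (hxy : ∀ t, t + 1 < R → x (t + 1) ≤ y t)
    (h : (∀ t, t + 1 < R → 1 ≤ y t + y (R - 1)) ∨
      ((∀ t < R, 0 ≤ x t) ∧ ∃ t₁ t₂, t₁ < t₂ ∧ t₂ + 1 < R ∧ 1 / 2 ≤ y t₁ - x (t₁ + 1) ∧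
        1 / 2 ≤ y t₂ - x (t₂ + 1))) :
    ∑ t ∈ (Finset.range R).erase s, x t ≤ ∑ t ∈ Finset.range R, y t := by
  obtain ⟨R, rfl⟩ : ∃ R', R = R' + 1 := ⟨R - 1, by omega⟩
  rw [Finset.sum_erase_eq_sub (Finset.mem_range.2 hs), Finset.sum_range_succ' x,
    Finset.sum_range_succ y]
  have hnn : ∀ t ∈ Finset.range R, 0 ≤ y t - x (t + 1) := fun t ht =>
    sub_nonneg.2 (hxy t (by simpa using ht))
  have hsum : ∑ t ∈ Finset.range R, (y t - x (t + 1)) =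
      ∑ t ∈ Finset.range R, y t - ∑ t ∈ Finset.range R, x (t + 1) := Finset.sum_sub_distrib _ _
  rcases s with _ | s
  · have := Finset.sum_nonneg hnn
    have := hy R (by omega)
    linarith
  rcases h with h | ⟨hx, t₁, t₂, h12, h2R, h1, h2⟩
  · have h1 := Finset.single_le_sum hnn (Finset.mem_range.2 (show s < R by omega))
    have h2 := h s hs
    simp only [Nat.add_sub_cancel] at h2
    linarith
  · have h3 := Finset.sum_le_sum_of_subset_of_nonneg (f := fun t => y t - x (t + 1))
      (show ({t₁, t₂} : Finset ℕ) ⊆ Finset.range R by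
        intro t ht; simp at ht; simp; omega) (fun t ht _ => hnn t ht)
    rw [Finset.sum_pair h12.ne] at h3
    have := hy R (by omega)
    have := hx (s + 1) hs
    linarith

/-- Equal rounds are compared termwise. If `x` has an extra last term and a term `s < r` is deleted,
the freed `y s` pays for the extra term. -/
theorem sum_erase_le_of_lead {x y : ℕ → ℝ} {r s R : ℕ} (hr : r ≤ R) (hR : R ≤ r + 1) (hs : s < R)
    (hx : ∀ t < R, 0 ≤ x t) (hxy : ∀ t < r, x t ≤ y t) (hlast : r < R → ∀ t < r, x r ≤ y t) :
    ∑ t ∈ (Finset.range R).erase s, x t ≤ ∑ t ∈ Finset.range r, y t := by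
  have hnn : ∀ t ∈ Finset.range r, 0 ≤ y t - x t := fun t ht =>
    sub_nonneg.2 (hxy t (by simpa using ht))
  have hsum : ∑ t ∈ Finset.range r, (y t - x t) =
      ∑ t ∈ Finset.range r, y t - ∑ t ∈ Finset.range r, x t := Finset.sum_sub_distrib _ _
  have h0 := Finset.sum_nonneg hnn
  rw [Finset.sum_erase_eq_sub (Finset.mem_range.2 hs)]
  rcases hr.eq_or_lt with rfl | hlt
  · have := hx s hs
    linarith
  · obtain rfl : R = r + 1 := by omega
    rw [Finset.sum_range_succ]
    rcases (Nat.lt_succ_iff.1 hs).eq_or_lt with rfl | hs'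
    · linarith
    · have h1 := Finset.single_le_sum hnn (Finset.mem_range.2 hs')
      have h2 := hlast (by omega) s hs'
      linarith

/-- A run of round-robin with reversed last round is envy-free up to any item if either the last
picks of each agent are valuable enough, or each agent profits sufficiently from two of the
picks made before those of an agent with a smaller number. -/
theorem isEFX_roundRobinReversedLast {n r q : ℕ} [NeZero n] [NeZero (r * n + q)] (hq : q < n)
    (u : Fin n → Fin (r * n + q) → ℝ) (h0 : ∀ i j, 0 ≤ u i j) (h1 : ∀ i j, u i j ≤ 1)
    (h : (∃ δ : ℝ, δ ≤ 1 / 2 ∧ (1 ≤ r → ∀ i, 1 - δ ≤ u i (pickOf r u i (r - 1))) ∧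
        (1 ≤ r → ∀ i : Fin n, n - q < i → δ ≤ u i (pickOf r u i r))) ∨
      (∀ i' i : Fin n, i' < i → ∃ t₁ t₂, t₁ < t₂ ∧ t₂ + 1 < r ∧
        1 / 2 ≤ u i (pickOf r u i t₁) - u i (pickOf r u i' (t₁ + 1)) ∧
        1 / 2 ≤ u i (pickOf r u i t₂) - u i (pickOf r u i' (t₂ + 1)))) :
    IsEFX u (roundRobinReversedLast u) := by
  intro i i' j hj
  rcases eq_or_ne i i' with rfl | hne
  · exact Finset.sum_le_sum_of_subset_of_nonneg (Finset.erase_subset _ _) fun k _ _ => h0 i k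
  rw [roundRobinReversedLast_eq_image hq] at hj
  obtain ⟨s, hs, rfl⟩ := Finset.mem_image.1 hj
  rw [Finset.mem_range] at hs
  rw [sum_erase_roundRobinReversedLast hq u _ _ hs, sum_roundRobinReversedLast hq]
  have hc := le_numTurns (r := r) (q := q) i
  have hc' := le_numTurns (r := r) (q := q) i'
  have hd' := numTurns_le (r := r) (q := q) i'
  rcases lt_or_gt_of_ne hne with hlt | hlt
  · refine (sum_erase_le_of_lead hc' hd' hs (fun t _ => h0 _ _)
      (y := fun t => u i (pickOf r u i t)) ?_ ?_).trans
      (Finset.sum_le_sum_of_subset_of_nonneg (Finset.range_mono hc) fun k _ _ => h0 _ _)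
    · intro t ht
      refine pickOf_le_pickOf hq u (ht.trans_le hc') ?_
      rw [turnOf_of_lt i ht, turnOf_of_lt i' ht]
      have : (i : ℕ) < i' := hlt
      omega
    · intro hr t ht
      exact pickOf_le_pickOf hq u hr (turnOf_lt_of_lt i i' ht ht).le
  · have hmono := numTurns_mono (r := r) (q := q) hlt.le
    refine (sum_erase_le_of_lag hs (y := fun t => u i (pickOf r u i t)) (fun t _ => h0 _ _)
      (h1 _ _) ?_ ?_).trans
      (Finset.sum_le_sum_of_subset_of_nonneg (Finset.range_mono hmono) fun k _ _ => h0 _ _)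
    · intro t ht
      exact pickOf_le_pickOf hq u ht (turnOf_lt_of_lt i i' (by omega) (by omega)).le
    · rcases h with ⟨δ, hδ, hA, hB⟩ | h
      · refine Or.inl fun t ht => ?_
        have hyt : 1 - δ ≤ u i (pickOf r u i t) := by
          refine (hA (by omega) i).trans (pickOf_le_pickOf hq u (by omega) ?_)
          rw [turnOf_of_lt i (by omega), turnOf_of_lt i (by omega)]
          exact Nat.add_le_add_right (Nat.mul_le_mul_right n (by omega)) _
        rcases hc'.eq_or_lt with heq | hlt'
        · rw [← heq]
          have := hA (by omega) i
          linarith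
        -- An extra item of `i'` forces `n - q ≤ i' < i`; hence the bound δ is never needed for the
        -- final picker `n - q`.
        · have heq : numTurns n r q i' = r + 1 := by omega
          have hi' : n - q ≤ i' := by
            unfold numTurns at heq
            split_ifs at heq with hh
            · exact hh
            · omega
          have := hB (by omega) i (lt_of_le_of_lt hi' hlt)
          rw [heq, Nat.add_sub_cancel]
          linarith
      · obtain ⟨t₁, t₂, h12, h2, h3, h4⟩ := h i' i hlt
        exact Or.inr ⟨fun t _ => h0 _ _, t₁, t₂, h12, by omega, h3, h4⟩

/-! ### Resampling some coordinates of a product measure -/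

/-- Fubini over the coordinates in `W`: each nonempty section of `A` lies in a cube with side `B`,
the matching section of `A'` contains the cube with side `B'`, and the cubes compare with factor θ
per coordinate. The sides may vary with the fibre, which takes the place of conditioning. -/
theorem pi_le_pow_mul_of_sections {I : Type*} [Fintype I] [DecidableEq I] {D : Measure ℝ}
    [IsProbabilityMeasure D] (W : Finset I) {A A' : Set (I → ℝ)} (hA : MeasurableSet A)
    (hA' : MeasurableSet A') {θ : ENNReal}
    (h : ∀ x ∈ A, ∃ B B' : Set ℝ, D B ≤ θ * D B' ∧
      (∀ x' ∈ A, (∀ k ∉ W, x' k = x k) → ∀ k ∈ W, x' k ∈ B) ∧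
      (∀ x', (∀ k ∉ W, x' k = x k) → (∀ k ∈ W, x' k ∈ B') → x' ∈ A')) :
    Measure.pi (fun _ : I => D) A ≤ θ ^ W.card * Measure.pi (fun _ : I => D) A' := by
  have hsec : ∀ (E : Set (I → ℝ)) (_ : MeasurableSet E) (x : I → ℝ),
      (∫⋯∫⁻_W, E.indicator 1 ∂(fun _ : I => D)) x =
        Measure.pi (fun _ : W => D) {y | Function.updateFinset x W y ∈ E} := by
    intro E hE x
    have h := lintegral_indicator_one (μ := Measure.pi fun _ : W => D)
      (measurable_updateFinset (x := x) (s := W) hE)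
    exact h
  rw [← lintegral_indicator_one hA, ← lintegral_indicator_one hA',
    ← lintegral_const_mul _ (measurable_one.indicator hA')]
  refine lintegral_le_of_lmarginal_le W (measurable_one.indicator hA)
    ((measurable_one.indicator hA').const_mul _) fun x => ?_
  have hr : (∫⋯∫⁻_W, (fun a => θ ^ W.card * A'.indicator 1 a) ∂(fun _ : I => D)) x =
      θ ^ W.card * (∫⋯∫⁻_W, A'.indicator 1 ∂(fun _ : I => D)) x := by
    rw [lmarginal, lmarginal, lintegral_const_mul]
    exact (measurable_one.indicator hA').comp measurable_updateFinset
  rw [hr, hsec A hA, hsec A' hA']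
  by_cases hne : ∃ y, Function.updateFinset x W y ∈ A
  · obtain ⟨y₀, hy₀⟩ := hne
    obtain ⟨B, B', hBB', h1, h2⟩ := h _ hy₀
    have hoff : ∀ y : W → ℝ, ∀ k ∉ W,
        Function.updateFinset x W y k = Function.updateFinset x W y₀ k := by
      intro y k hk
      simp [Function.updateFinset, hk]
    calc Measure.pi (fun _ : W => D) {y | Function.updateFinset x W y ∈ A}
        ≤ Measure.pi (fun _ : W => D) (Set.univ.pi fun _ => B) := by
          refine measure_mono fun y hy k _ => ?_
          have := h1 _ hy (hoff y) k k.2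
          simpa [Function.updateFinset] using this
      _ = D B ^ W.card := by simp [Measure.pi_pi]
      _ ≤ (θ * D B') ^ W.card := by gcongr
      _ = θ ^ W.card * Measure.pi (fun _ : W => D) (Set.univ.pi fun _ => B') := by
          simp [Measure.pi_pi, mul_pow]
      _ ≤ _ := by
          gcongr
          refine fun y hy => h2 _ (hoff y) fun k hk => ?_
          have := hy ⟨k, hk⟩ (Set.mem_univ _)
          simpa [Function.updateFinset, hk] using this
  · have : {y | Function.updateFinset x W y ∈ A} = ∅ := by
      ext y; simpa using fun hy => hne ⟨y, hy⟩
    simp [this]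

/-! ### Measurability of the run -/

theorem mostPreferred_congr {m : ℕ} {v w : Fin m → ℝ} (h : ∀ j k, v j ≤ v k ↔ w j ≤ w k)
    (S : Finset (Fin m)) : mostPreferred v S = mostPreferred w S := by
  ext b; simp [mem_mostPreferred, h]

theorem favourite_congr {m : ℕ} [NeZero m] {v w : Fin m → ℝ} (h : ∀ j k, v j ≤ v k ↔ w j ≤ w k)
    (S : Finset (Fin m)) : favourite v S = favourite w S := by
  unfold favourite
  simp only [mostPreferred_congr h]

theorem remaining_congr_of_le_iff {n m : ℕ} [NeZero m] (σ : ℕ → Fin n) {u u' : Fin n → Fin m → ℝ}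
    (h : ∀ i j k, u i j ≤ u i k ↔ u' i j ≤ u' i k) (k : ℕ) :
    remaining σ u k = remaining σ u' k := by
  induction k with
  | zero => rfl
  | succ k ih => rw [remaining_succ, remaining_succ, picked, picked, ih, favourite_congr (h _)]

theorem picked_congr_of_le_iff {n m : ℕ} [NeZero m] (σ : ℕ → Fin n) {u u' : Fin n → Fin m → ℝ}
    (h : ∀ i j k, u i j ≤ u i k ↔ u' i j ≤ u' i k) (k : ℕ) :
    picked σ u k = picked σ u' k := by
  rw [picked, picked, remaining_congr_of_le_iff σ h, favourite_congr (h _)]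

/-- Such a set is a preimage under the measurable map to comparison patterns, of which there are
finitely many. -/
theorem measurableSet_of_le_iff {n m : ℕ} {s : Set (Fin n × Fin m → ℝ)}
    (h : ∀ x x' : Fin n × Fin m → ℝ,
      (∀ i j k, x (i, j) ≤ x (i, k) ↔ x' (i, j) ≤ x' (i, k)) → x ∈ s → x' ∈ s) :
    MeasurableSet s := by
  let pat : (Fin n × Fin m → ℝ) → (Fin n → Fin m → Fin m → Prop) :=
    fun x i j k => x (i, j) ≤ x (i, k)
  have hpat : Measurable pat := by
    refine measurable_pi_lambda _ fun i => measurable_pi_lambda _ fun j =>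
      measurable_pi_lambda _ fun k => ?_
    exact measurableSet_setOfPred.1
      (measurableSet_le (measurable_pi_apply (i, j)) (measurable_pi_apply (i, k)))
  have : s = pat ⁻¹' (pat '' s) := by
    refine Set.Subset.antisymm (Set.subset_preimage_image _ _) ?_
    rintro x' ⟨x, hx, hxx'⟩
    refine h x x' (fun i j k => ?_) hx
    exact iff_of_eq (congrFun (congrFun (congrFun hxx' i) j) k)
  rw [this]
  exact hpat (Set.toFinite _).measurableSet

section Run

variable {n m : ℕ} [NeZero m] (σ : ℕ → Fin n)

theorem measurableSet_remaining_eq (k : ℕ) (T : Finset (Fin m)) :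
    MeasurableSet {x : Fin n × Fin m → ℝ | remaining σ (Function.curry x) k = T} :=
  measurableSet_of_le_iff fun _ _ h hx =>
    (remaining_congr_of_le_iff σ (fun i j k => (h i j k).symm) k).trans hx

theorem measurableSet_picked_eq (k : ℕ) (b : Fin m) :
    MeasurableSet {x : Fin n × Fin m → ℝ | picked σ (Function.curry x) k = b} :=
  measurableSet_of_le_iff fun _ _ h hx =>
    (picked_congr_of_le_iff σ (fun i j k => (h i j k).symm) k).trans hx

theorem measurable_apply_picked (i : Fin n) (k : ℕ) :
    Measurable fun x : Fin n × Fin m → ℝ => x (i, picked σ (Function.curry x) k) := by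
  have : (fun x : Fin n × Fin m → ℝ => x (i, picked σ (Function.curry x) k)) =
      fun x => ∑ b, if picked σ (Function.curry x) k = b then x (i, b) else 0 := by
    funext x; simp
  rw [this]
  exact Finset.measurable_sum _ fun b _ => Measurable.ite (measurableSet_picked_eq σ k b)
    (measurable_pi_apply _) measurable_const

/-! ### Probability estimates for the run -/

variable {D : Measure ℝ} [IsProbabilityMeasure D]

/-- If `lab` is determined by the run before turn `s` and by the values for agent `i` of the items
picked before, and if all values of the remaining items for agent `i` could be resampled below
`lab` without changing the run, then it is unlikely that they all lie below `g lab`. -/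
theorem measure_forall_remaining_lt_le {s : ℕ} (hs : s ≤ m) (i : Fin n)
    {lab : (Fin n × Fin m → ℝ) → ℝ} (hlab : Measurable lab)
    (hstab : ∀ x x' : Fin n × Fin m → ℝ,
      (∀ p, (p.1 = i → p.2 ∉ remaining σ (Function.curry x) s) → x' p = x p) →
      (∀ c ∈ remaining σ (Function.curry x) s, x' (i, c) < lab x) →
      remaining σ (Function.curry x') s = remaining σ (Function.curry x) s ∧ lab x' = lab x)
    {g : ℝ → ℝ} (hg : Measurable g) {Y : Set ℝ} (hY : MeasurableSet Y)
    (hgY : ∀ y ∈ Y, g y ≤ y) {θ : ENNReal}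
    (hθ : ∀ y ∈ Y, D (Set.Iio (g y)) ≤ θ * D (Set.Iio y)) :
    Measure.pi (fun _ : Fin n × Fin m => D)
      {x | lab x ∈ Y ∧ ∀ c ∈ remaining σ (Function.curry x) s, x (i, c) < g (lab x)} ≤
        θ ^ (m - s) := by
  set π := Measure.pi (fun _ : Fin n × Fin m => D)
  let R : Finset (Fin m) → Set (Fin n × Fin m → ℝ) :=
    fun T => (fun x => remaining σ (Function.curry x) s) ⁻¹' {T}
  let A : Finset (Fin m) → Set (Fin n × Fin m → ℝ) :=
    fun T => R T ∩ (lab ⁻¹' Y ∩ ⋂ c ∈ T, {x | x (i, c) < g (lab x)})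
  have hR : ∀ T, MeasurableSet (R T) := measurableSet_remaining_eq σ s
  have hA : ∀ T, MeasurableSet (A T) := fun T => (hR T).inter <| (hlab hY).inter <|
    Finset.measurableSet_biInter _ fun c _ =>
      measurableSet_lt (measurable_pi_apply _) (hg.comp hlab)
  have key : ∀ T, π (A T) ≤ θ ^ (m - s) * π (R T) := by
    intro T
    by_cases hne : (A T).Nonempty
    swap
    · rw [Set.not_nonempty_iff_eq_empty.1 hne]; simp
    obtain ⟨x₀, hx₀⟩ := hne
    have hcard : T.card = m - s := by
      rw [← show remaining σ (Function.curry x₀) s = T from hx₀.1, card_remaining σ _ hs]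
    have := pi_le_pow_mul_of_sections (D := D) (({i} : Finset (Fin n)) ×ˢ T) (hA T) (hR T)
      (θ := θ) ?_
    · rwa [Finset.card_product, Finset.card_singleton, one_mul, hcard] at this
    rintro x ⟨hxR, hxY, hxlt⟩
    have hxR : remaining σ (Function.curry x) s = T := hxR
    simp only [Set.mem_iInter, Set.mem_ofPred_eq] at hxlt
    refine ⟨Set.Iio (g (lab x)), Set.Iio (lab x), hθ _ hxY, ?_, ?_⟩
    · rintro x' ⟨hxR', hxY', hxlt'⟩ hoff ⟨j, c⟩ hjc
      have hxR' : remaining σ (Function.curry x') s = T := hxR'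
      simp only [Set.mem_iInter, Set.mem_ofPred_eq] at hxlt'
      simp only [Finset.mem_product, Finset.mem_singleton] at hjc
      obtain ⟨rfl, hc⟩ := hjc
      -- `lab` is constant on the part of a fibre inside `A T`: from the point with the larger
      -- label, the other point is an admissible resampling, as its values lie below its own,
      -- smaller label.
      have hlabeq : lab x' = lab x := by
        rcases le_total (lab x) (lab x') with hle | hle
        · refine (hstab x' x (fun p hp => (hoff p ?_).symm) fun c hc => ?_).2.symm
          · rw [hxR'] at hp
            simpa only [Finset.mem_product, Finset.mem_singleton, not_and] using hp
          · exact ((hxlt c (hxR' ▸ hc)).trans_le (hgY _ hxY)).trans_le hle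
        · refine (hstab x x' (fun p hp => (hoff p ?_)) fun c hc => ?_).2
          · rw [hxR] at hp
            simpa only [Finset.mem_product, Finset.mem_singleton, not_and] using hp
          · exact ((hxlt' c (hxR ▸ hc)).trans_le (hgY _ hxY')).trans_le hle
      rw [Set.mem_Iio, ← hlabeq]
      exact hxlt' c hc
    · intro x' hoff hlt
      refine (hstab x x' (fun p hp => hoff p ?_) fun c hc => ?_).1.trans hxR
      · rw [hxR] at hp
        simpa only [Finset.mem_product, Finset.mem_singleton, not_and] using hp
      · exact hlt (i, c) (by simpa using hxR ▸ hc)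
  calc π {x | lab x ∈ Y ∧ ∀ c ∈ remaining σ (Function.curry x) s, x (i, c) < g (lab x)}
      ≤ π (⋃ T ∈ (Finset.univ : Finset (Finset (Fin m))), A T) := by
        refine measure_mono fun x hx => ?_
        simp only [Finset.mem_univ, Set.iUnion_true, Set.mem_iUnion]
        refine ⟨remaining σ (Function.curry x) s, rfl, hx.1, ?_⟩
        simpa using hx.2
    _ ≤ ∑ T, π (A T) := measure_biUnion_finset_le _ _
    _ ≤ ∑ T, θ ^ (m - s) * π (R T) := Finset.sum_le_sum fun T _ => key T
    _ = θ ^ (m - s) * ∑ T, π (R T) := (Finset.mul_sum _ _ _).symm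
    _ = θ ^ (m - s) := by
        rw [sum_measure_preimage_singleton _ fun T _ => hR T]
        simp [π]

/-- Before the first turn of agent `i`, the run does not depend on the values for agent `i`. -/
theorem measure_forall_remaining_lt_le_of_first {s : ℕ} (hs : s ≤ m) (i : Fin n)
    (hfirst : ∀ k < s, σ k ≠ i) {a : ℝ} {θ : ENNReal}
    (ha : a ≤ 1) (hθ : D (Set.Iio a) ≤ θ * D (Set.Iio 1)) :
    Measure.pi (fun _ : Fin n × Fin m => D)
      {x | ∀ c ∈ remaining σ (Function.curry x) s, x (i, c) < a} ≤ θ ^ (m - s) := by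
  have := measure_forall_remaining_lt_le σ (D := D) hs i (lab := fun _ => 1) measurable_const
    (g := fun _ => a) ?_ measurable_const (Y := {1}) (measurableSet_singleton _)
    (by simpa using ha) (θ := θ) (by simpa using hθ)
  · simpa using this
  · intro x x' heq _
    refine ⟨remaining_congr σ (i := i) (T := remaining σ (Function.curry x) s) hs subset_rfl ?_ ?_
      le_rfl, rfl⟩
    · intro j c hjc
      exact heq (j, c) hjc
    · intro k hk hki
      exact absurd hki (hfirst k hk)

/-- Agent `i` values its own picks up to turn `p` at least as much as the item picked at `p`, so one
bound at turn `p` dominates all the constraints that its earlier choices impose. -/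
theorem run_congr_of_lt_last {p s : ℕ} (hs : s ≤ m) (hps : p < s) {i : Fin n}
    (hlast : ∀ k < s, σ k = i → k ≤ p) {x x' : Fin n × Fin m → ℝ} {T : Finset (Fin m)}
    (hT : T ⊆ remaining σ (Function.curry x) s)
    (heq : ∀ p, (p.1 = i → p.2 ∉ T) → x' p = x p)
    (hlt : ∀ c ∈ T, x' (i, c) < x (i, picked σ (Function.curry x) p)) :
    (∀ k ≤ s, remaining σ (Function.curry x') k = remaining σ (Function.curry x) k) ∧
    (∀ k < s, picked σ (Function.curry x') k = picked σ (Function.curry x) k) ∧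
    ∀ k < s, x' (i, picked σ (Function.curry x') k) = x (i, picked σ (Function.curry x) k) := by
  have heq' : ∀ j c, (j = i → c ∉ T) → Function.curry x' j c = Function.curry x j c :=
    fun j c hjc => heq (j, c) hjc
  have hlt' : ∀ k < s, σ k = i → ∀ c ∈ T, Function.curry x' i c <
      Function.curry x i (picked σ (Function.curry x) k) := by
    intro k hk hki c hc
    refine (hlt c hc).trans_le ?_
    have := picked_le_picked σ (Function.curry x) (hlast k hk hki) (hps.trans_le hs)
    rwa [hki] at this
  have hpick : ∀ k < s, picked σ (Function.curry x') k = picked σ (Function.curry x) k :=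
    fun k hk => picked_congr_of_lt σ hs hT heq' hlt' hk
  refine ⟨fun k hk => remaining_congr σ hs hT heq' hlt' hk, hpick, fun k hk => ?_⟩
  rw [hpick k hk]
  exact heq _ fun _ h => picked_notMem σ _ hk (hT h)

/-- Conditionally on the run before turn `s`, it is unlikely that the values for agent `i` of all
remaining items are much smaller than the value `y` of the last item picked by agent `i`. -/
theorem measure_forall_remaining_lt_le_of_last {p s : ℕ} (hs : s ≤ m) (hps : p < s) {i : Fin n}
    (hlast : ∀ k < s, σ k = i → k ≤ p) {g : ℝ → ℝ} (hg : Measurable g) {Y : Set ℝ}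
    (hY : MeasurableSet Y) (hgY : ∀ y ∈ Y, g y ≤ y) {θ : ENNReal}
    (hθ : ∀ y ∈ Y, D (Set.Iio (g y)) ≤ θ * D (Set.Iio y)) :
    Measure.pi (fun _ : Fin n × Fin m => D)
      {x | x (i, picked σ (Function.curry x) p) ∈ Y ∧ ∀ c ∈ remaining σ (Function.curry x) s,
        x (i, c) < g (x (i, picked σ (Function.curry x) p))} ≤ θ ^ (m - s) := by
  refine measure_forall_remaining_lt_le σ hs i (measurable_apply_picked σ i p) ?_ hg hY hgY hθ
  intro x x' heq hlt
  have := run_congr_of_lt_last σ hs hps hlast subset_rfl heq hlt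
  exact ⟨this.1 s le_rfl, this.2.2 p hps⟩

/-- It is unlikely that, for agent `i`, all items which are picked in the turns `s 0, s 1, …` of
other agents have a value greater than `a`. -/
theorem measure_forall_lt_picked_le {s p : ℕ → ℕ} {i : Fin n} (hmono : StrictMono s) (L : ℕ)
    (hs : ∀ l < L, s l < m) (hps : ∀ l < L, p l < s l) (hp : ∀ l < L, σ (p l) = i)
    (hσ : ∀ l < L, σ (s l) ≠ i) (hlast : ∀ l < L, ∀ k < s l, σ k = i → k ≤ p l) {a : ℝ}
    {θ : ENNReal} (hθ : ∀ y, D (Set.Ioc a y) ≤ θ * D (Set.Iio y)) :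
    Measure.pi (fun _ : Fin n × Fin m => D)
      {x | ∀ l < L, a < x (i, picked σ (Function.curry x) (s l))} ≤ θ ^ L := by
  set π := Measure.pi (fun _ : Fin n × Fin m => D)
  induction L with
  | zero => simp [π]
  | succ L ih =>
    have ih := ih (fun l hl => hs l (by omega)) (fun l hl => hps l (by omega))
      (fun l hl => hp l (by omega)) (fun l hl => hσ l (by omega)) (fun l hl => hlast l (by omega))
    replace hs := hs L (by omega)
    replace hps := hps L (by omega)
    replace hp := hp L (by omega)
    replace hσ := hσ L (by omega)
    replace hlast := hlast L (by omega)
    set Z := {x : Fin n × Fin m → ℝ | ∀ l < L, a < x (i, picked σ (Function.curry x) (s l))}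
      with hZdef
    have hZ : MeasurableSet Z := by
      have : Z = ⋂ l ∈ Finset.range L,
          {x | a < x (i, picked σ (Function.curry x) (s l))} := by
        ext x; simp [hZdef]
      rw [this]
      exact Finset.measurableSet_biInter _ fun l _ =>
        measurableSet_lt measurable_const (measurable_apply_picked σ i _)
    -- Fixing both picked items makes the coordinate to be resampled, and the one bounding it,
    -- deterministic.
    let f : (Fin n × Fin m → ℝ) → Fin m × Fin m :=
      fun x => (picked σ (Function.curry x) (p L), picked σ (Function.curry x) (s L))
    have hf : ∀ b, MeasurableSet (f ⁻¹' {b}) := by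
      rintro ⟨b, c⟩
      have : f ⁻¹' {(b, c)} = {x | picked σ (Function.curry x) (p L) = b} ∩
          {x | picked σ (Function.curry x) (s L) = c} := by
        ext x; simp [f, Prod.ext_iff]
      rw [this]
      exact (measurableSet_picked_eq σ _ _).inter (measurableSet_picked_eq σ _ _)
    have key : ∀ b : Fin m × Fin m, π (Z ∩ f ⁻¹' {b} ∩ {x | a < x (i, b.2)}) ≤
        θ * π (Z ∩ f ⁻¹' {b}) := by
      rintro ⟨b, c⟩
      have := pi_le_pow_mul_of_sections (D := D) ({(i, c)} : Finset (Fin n × Fin m))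
        (A := Z ∩ f ⁻¹' {(b, c)} ∩ {x | a < x (i, c)}) (A' := Z ∩ f ⁻¹' {(b, c)})
        ((hZ.inter (hf _)).inter (measurableSet_lt measurable_const (measurable_pi_apply _)))
        (hZ.inter (hf _)) (θ := θ) ?_
      · simpa using this
      rintro x ⟨⟨hxZ, hxf⟩, hxa⟩
      have hfx := hxf
      simp only [f, Set.mem_preimage, Set.mem_singleton_iff, Prod.mk.injEq] at hfx
      obtain ⟨hb, hc⟩ := hfx
      have hbc : b ≠ c := by
        rintro rfl
        have := picked_injOn σ (Function.curry x) (hps.trans hs) hs (hb.trans hc.symm)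
        omega
      -- The run only gives a weak inequality with the value of `b`, whereas stability under
      -- resampling needs a strict one.
      refine ⟨Set.Ioc a (x (i, b)), Set.Iio (x (i, b)), hθ _, ?_, ?_⟩
      · rintro x' ⟨⟨_, hxf'⟩, hxa'⟩ hoff k hk
        simp only [f, Set.mem_preimage, Set.mem_singleton_iff, Prod.mk.injEq] at hxf'
        obtain rfl := Finset.mem_singleton.1 hk
        refine ⟨hxa', ?_⟩
        rw [← hoff (i, b) (by simpa using hbc)]
        have := picked_le_picked σ (Function.curry x') hps.le hs
        rwa [hxf'.1, hxf'.2, hp] at this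
      · intro x' hoff hlt
        have hrun := run_congr_of_lt_last σ (x := x) (x' := x') (T := {c}) hs.le hps hlast
          (by simpa [← hc] using picked_mem σ _ hs)
          (fun k hk => hoff k fun h => by
            obtain rfl := Finset.mem_singleton.1 h
            simp at hk)
          (fun d hd => by
            obtain rfl := Finset.mem_singleton.1 hd
            rw [hb]
            exact hlt _ (Finset.mem_singleton_self _))
        refine ⟨fun l hl => ?_, ?_⟩
        · rw [hrun.2.2 _ (hmono hl)]
          exact hxZ l hl
        · simp only [f, Set.mem_preimage, Set.mem_singleton_iff, Prod.mk.injEq]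
          refine ⟨(hrun.2.1 _ hps).trans hb, ?_⟩
          -- Turn `s L` belongs to another agent, whose choice ignores the values of `i`.
          rw [← hc, picked, picked, hrun.1 _ le_rfl]
          congr 1
          funext d
          exact hoff _ fun h => hσ (by simpa using congrArg Prod.fst (Finset.mem_singleton.1 h))
    calc π {x | ∀ l < L + 1, a < x (i, picked σ (Function.curry x) (s l))}
        ≤ π (⋃ b ∈ (Finset.univ : Finset (Fin m × Fin m)),
            Z ∩ f ⁻¹' {b} ∩ {x | a < x (i, b.2)}) := by
          refine measure_mono fun x hx => ?_
          simp only [Finset.mem_univ, Set.iUnion_true, Set.mem_iUnion]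
          exact ⟨f x, ⟨fun l hl => hx l (by omega), rfl⟩, hx L (by omega)⟩
      _ ≤ ∑ b, π (Z ∩ f ⁻¹' {b} ∩ {x | a < x (i, b.2)}) := measure_biUnion_finset_le _ _
      _ ≤ ∑ b, θ * π (Z ∩ f ⁻¹' {b}) := Finset.sum_le_sum fun b _ => key b
      _ = θ * ∑ b, π.restrict Z (f ⁻¹' {b}) := by
          rw [← Finset.mul_sum]
          congr 1
          refine Finset.sum_congr rfl fun b _ => ?_
          rw [Measure.restrict_apply (hf b), Set.inter_comm]
      _ = θ * π Z := by
          rw [sum_measure_preimage_singleton _ fun T _ => hf T]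
          simp
      _ ≤ θ * θ ^ L := by gcongr
      _ = θ ^ (L + 1) := (pow_succ' _ _).symm

end Run

/-! ### Distributions with bounded density -/

namespace IsPDFBounded

theorem measure_eq {α β : ℝ} {D : Measure ℝ} (hD : IsPDFBounded α β D) : ∃ f : ℝ → ℝ,
    (∀ x ∈ Set.Icc (0 : ℝ) 1, α ≤ f x ∧ f x ≤ β) ∧ ∀ S, MeasurableSet S →
      D S = ∫⁻ x in S ∩ Set.Icc 0 1, ENNReal.ofReal (f x) := by
  obtain ⟨f, _, hf, rfl⟩ := hD
  refine ⟨f, hf, fun S hS => ?_⟩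
  rw [withDensity_apply _ hS, Measure.restrict_restrict hS]

theorem measure_singleton {α β : ℝ} {D : Measure ℝ} (hD : IsPDFBounded α β D) (y : ℝ) :
    D {y} = 0 := by
  obtain ⟨f, -, h⟩ := hD.measure_eq
  rw [h _ (measurableSet_singleton y)]
  exact setLIntegral_measure_zero _ _ (measure_mono_null Set.inter_subset_left (by simp))

theorem measure_compl_Icc {α β : ℝ} {D : Measure ℝ} (hD : IsPDFBounded α β D) :
    D (Set.Icc 0 1)ᶜ = 0 := by
  obtain ⟨f, -, h⟩ := hD.measure_eq
  rw [h _ measurableSet_Icc.compl]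
  simp

theorem measureReal_Iio_le {α β : ℝ} {D : Measure ℝ} (hD : IsPDFBounded α β D)
    (hβ : 0 < β) {b : ℝ} (hb : 0 ≤ b) :
    D.real (Set.Iio b) ≤ β * b := by
  obtain ⟨f, hf, h⟩ := hD.measure_eq
  refine ENNReal.toReal_le_of_le_ofReal (by positivity) ?_
  rw [h _ measurableSet_Iio]
  calc ∫⁻ x in Set.Iio b ∩ Set.Icc 0 1, ENNReal.ofReal (f x)
      ≤ ∫⁻ _ in Set.Iio b ∩ Set.Icc 0 1, ENNReal.ofReal β :=
        setLIntegral_mono' (measurableSet_Iio.inter measurableSet_Icc) fun x hx =>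
          ENNReal.ofReal_le_ofReal (hf x hx.2).2
    _ = ENNReal.ofReal β * volume (Set.Iio b ∩ Set.Icc 0 1) := setLIntegral_const _ _
    _ ≤ ENNReal.ofReal β * volume (Set.Ico 0 b) := by
        gcongr
        exact fun x hx => ⟨hx.2.1, hx.1⟩
    _ = ENNReal.ofReal (β * b) := by
        rw [Real.volume_Ico, sub_zero, ENNReal.ofReal_mul hβ.le]

variable {α β : ℝ} {D : Measure ℝ} [IsProbabilityMeasure D]

theorem le_measureReal_Ico (hD : IsPDFBounded α β D) (hα : 0 < α) {a b : ℝ} (ha : 0 ≤ a)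
    (hb : b ≤ 1) : α * (b - a) ≤ D.real (Set.Ico a b) := by
  obtain ⟨f, hf, h⟩ := hD.measure_eq
  have hsub : Set.Ico a b ∩ Set.Icc 0 1 = Set.Ico a b :=
    Set.inter_eq_left.2 fun x hx => ⟨ha.trans hx.1, hx.2.le.trans hb⟩
  rw [Measure.real, ← ENNReal.ofReal_le_iff_le_toReal (measure_ne_top _ _),
    h _ measurableSet_Ico, hsub, ENNReal.ofReal_mul hα.le, ← Real.volume_Ico,
    ← setLIntegral_const]
  refine setLIntegral_mono' measurableSet_Ico fun x hx => ?_
  exact ENNReal.ofReal_le_ofReal (hf x ⟨ha.trans hx.1, hx.2.le.trans hb⟩).1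

theorem measureReal_Iio_eq_add {a b : ℝ} (hab : a ≤ b) :
    D.real (Set.Iio b) = D.real (Set.Iio a) + D.real (Set.Ico a b) := by
  rw [← measureReal_union _ measurableSet_Ico, Set.Iio_union_Ico_eq_Iio hab]
  exact Set.disjoint_left.2 fun x hx hx' => not_lt.2 hx'.1 hx

theorem le_one (hD : IsPDFBounded α β D) (hα : 0 < α) : α ≤ 1 := by
  have := hD.le_measureReal_Ico hα le_rfl le_rfl
  have := measureReal_le_one (μ := D) (s := Set.Ico 0 1)
  linarith

/-- If `y - d` is positive, the interval `[y - d, y)` carries mass at least `α * d`, hence at least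
that fraction of the mass below `y`, which is at most 1. Otherwise the left side vanishes. -/
theorem measureReal_Iio_sub_le (hD : IsPDFBounded α β D) (hα : 0 < α) {y d : ℝ} (hy : y ≤ 1)
    (hd : 0 ≤ d) (hd1 : d ≤ 1) :
    D.real (Set.Iio (y - d)) ≤ (1 - α * d) * D.real (Set.Iio y) := by
  have hα1 := hD.le_one hα
  have hαd : α * d ≤ 1 := by nlinarith
  have h1 := measureReal_le_one (μ := D) (s := Set.Iio y)
  have h0 := measureReal_nonneg (μ := D) (s := Set.Iio y)
  rcases le_total (y - d) 0 with h | h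
  · have : D.real (Set.Iio (y - d)) = 0 := by
      rw [measureReal_eq_zero_iff]
      refine measure_mono_null (fun x hx => ?_) hD.measure_compl_Icc
      exact fun hx' => absurd (hx'.1.trans_lt hx) (not_lt.2 h)
    rw [this]
    exact mul_nonneg (by linarith) h0
  · have h2 := measureReal_Iio_eq_add (D := D) (show y - d ≤ y by linarith)
    have h3 := hD.le_measureReal_Ico hα h hy
    have h4 : α * d * D.real (Set.Iio y) ≤ α * d * 1 :=
      mul_le_mul_of_nonneg_left h1 (by positivity)
    rw [show y - (y - d) = d by ring] at h3
    linarith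

theorem measureReal_Iio_le_mul (hD : IsPDFBounded α β D) (hα : 0 < α) (hβ : 0 < β) {y d : ℝ}
    (hy : 1 / 2 ≤ y) (hd : 0 ≤ d) :
    D.real (Set.Iio d) ≤ 2 * β * d / α * D.real (Set.Iio y) := by
  have h1 := hD.measureReal_Iio_le hβ hd
  have h2 : α / 2 ≤ D.real (Set.Iio y) := by
    have h3 := hD.le_measureReal_Ico hα le_rfl (show (1 / 2 : ℝ) ≤ 1 by norm_num)
    have h4 : D.real (Set.Ico 0 (1 / 2)) ≤ D.real (Set.Iio y) :=
      measureReal_mono fun x hx => hx.2.trans_le hy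
    linarith
  calc D.real (Set.Iio d) ≤ β * d := h1
    _ = 2 * β * d / α * (α / 2) := by field_simp
    _ ≤ _ := by gcongr

theorem measureReal_Ioc_le (hD : IsPDFBounded α β D) (hα : 0 < α) {a : ℝ} (ha : 0 ≤ a)
    (ha1 : a ≤ 1) (y : ℝ) : D.real (Set.Ioc a y) ≤ (1 - α * a) * D.real (Set.Iio y) := by
  have hα1 := hD.le_one hα
  have hαa : α * a ≤ 1 := by nlinarith
  have h0 := measureReal_nonneg (μ := D) (s := Set.Iio y)
  rcases le_total y a with h | h
  · rw [Set.Ioc_eq_empty (not_lt.2 h), measureReal_empty]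
    exact mul_nonneg (by linarith) h0
  · have h1 := measureReal_le_one (μ := D) (s := Set.Iio y)
    have h2 := measureReal_Iio_eq_add (D := D) h
    have h3 : α * a ≤ D.real (Set.Iio a) := by
      have := hD.le_measureReal_Ico hα le_rfl ha1
      rw [sub_zero] at this
      exact this.trans (measureReal_mono fun x hx => hx.2)
    have h4 : D.real (Set.Ioc a y) ≤ D.real (Set.Ico a y) := by
      have h5 : D.real (Set.Ioc a y) ≤ D.real (Set.Ico a y ∪ {y}) :=
        measureReal_mono fun x hx => by
          rcases hx.2.lt_or_eq with h | h
          · exact Or.inl ⟨hx.1.le, h⟩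
          · exact Or.inr h
      have h6 := measureReal_union_le (μ := D) (Set.Ico a y) {y}
      have h7 : D.real {y} = 0 := by rw [measureReal_eq_zero_iff]; exact hD.measure_singleton y
      linarith
    have h5 : α * a * D.real (Set.Iio y) ≤ α * a * 1 :=
      mul_le_mul_of_nonneg_left h1 (by positivity)
    linarith

end IsPDFBounded

theorem measure_le_ofReal_mul {D : Measure ℝ} [IsProbabilityMeasure D] {A B : Set ℝ} {θ : ℝ}
    (h : D.real A ≤ θ * D.real B) (hθ : 0 ≤ θ) : D A ≤ ENNReal.ofReal θ * D B := by
  rw [← ofReal_measureReal (μ := D) (s := A), ← ofReal_measureReal (μ := D) (s := B),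
    ← ENNReal.ofReal_mul hθ]
  exact ENNReal.ofReal_le_ofReal h

theorem measureReal_le_pow {Ω : Type*} [MeasurableSpace Ω] {μ : Measure Ω} {A : Set Ω} {θ : ℝ}
    {N : ℕ} (hθ : 0 ≤ θ) (h : μ A ≤ ENNReal.ofReal θ ^ N) : μ.real A ≤ θ ^ N := by
  refine ENNReal.toReal_le_of_le_ofReal (by positivity) ?_
  rwa [ENNReal.ofReal_pow hθ]

/-! ### Geometric sums -/

theorem sum_pow_add_sub_le {ρ : ℝ} (h0 : 0 ≤ ρ) (h1 : ρ < 1) (n q : ℕ) :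
    ∑ i : Fin n, ρ ^ (n + q - i) ≤ ρ ^ q / (1 - ρ) := by
  calc ∑ i : Fin n, ρ ^ (n + q - i) ≤ ∑ i : Fin n, ρ ^ q * ρ ^ (n - 1 - (i : ℕ)) := by
        refine Finset.sum_le_sum fun i _ => ?_
        rw [← pow_add]
        exact pow_le_pow_of_le_one h0 h1.le (by omega)
    _ = ρ ^ q * ∑ i ∈ Finset.range n, ρ ^ i := by
        rw [← Finset.mul_sum, Fin.sum_univ_eq_sum_range fun i => ρ ^ (n - 1 - i),
          Finset.sum_range_reflect]
    _ ≤ ρ ^ q * (1 - ρ)⁻¹ := by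
        gcongr
        exact (summable_geometric_of_lt_one h0 h1).sum_le_tsum _ (fun _ _ => by positivity)
          |>.trans_eq (tsum_geometric_of_lt_one h0 h1)
    _ = _ := rfl

/-- The strict inequality in the filter makes the exponents start at 2, the source of the order δ²
in the reversed round. -/
theorem sum_pow_sub_le {ρ : ℝ} (h0 : 0 ≤ ρ) (h1 : ρ ≤ 1 / 2) (n a : ℕ) :
    ∑ i ∈ Finset.univ.filter (fun i : Fin n => a < (i : ℕ)), ρ ^ ((i : ℕ) + 1 - a) ≤ 2 * ρ ^ 2 := by
  have hρ1 : ρ < 1 := by linarith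
  rw [Finset.sum_filter, Fin.sum_univ_eq_sum_range fun i => if a < i then ρ ^ (i + 1 - a) else 0,
    ← Finset.sum_filter]
  have hIco : (Finset.range n).filter (fun i => a < i) = Finset.Ico (a + 1) n := by
    ext i; simp only [Finset.mem_filter, Finset.mem_range, Finset.mem_Ico]; omega
  rw [hIco, Finset.sum_Ico_eq_sum_range]
  calc ∑ k ∈ Finset.range (n - (a + 1)), ρ ^ (a + 1 + k + 1 - a)
      = ρ ^ 2 * ∑ k ∈ Finset.range (n - (a + 1)), ρ ^ k := by
        rw [Finset.mul_sum]
        refine Finset.sum_congr rfl fun k _ => ?_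
        rw [← pow_add]
        congr 1
        omega
    _ ≤ ρ ^ 2 * (1 - ρ)⁻¹ := by
        gcongr
        exact (summable_geometric_of_lt_one h0 hρ1).sum_le_tsum _ (fun _ _ => by positivity)
          |>.trans_eq (tsum_geometric_of_lt_one h0 hρ1)
    _ ≤ ρ ^ 2 * 2 := by
        gcongr
        exact inv_le_of_inv_le₀ (by norm_num) (by linarith)
    _ = 2 * ρ ^ 2 := mul_comm _ _

/-! ### The picks of a single agent -/

/-- The value for agent `i` of the item picked in the previous round (or `1` in the first round). -/
noncomputable def prevValue {n m : ℕ} [NeZero n] [NeZero m] (r : ℕ) (u : Fin n → Fin m → ℝ)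
    (i : Fin n) : ℕ → ℝ
  | 0 => 1
  | t + 1 => u i (pickOf r u i t)

/-- This supplies the last turn of `i` before the turn of interest. For `i' < i` the latter must be
regular: in the reversed round `i` would move before `i'`. -/
theorem le_turnOf_of_turn_eq {n r q : ℕ} [NeZero n] (hq : q < n) {i i' : Fin n} {t k : ℕ}
    (ht : t < r) (hi : i' = i ∨ i' < i ∧ t + 1 < r) (hk : k < turnOf n r i' (t + 1))
    (hkq : k < r * n + q) (hki : turn n r k = i) : k ≤ turnOf n r i t := by
  subst hki
  obtain ⟨t', ht', hk'⟩ := exists_turnOf_eq hq hkq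
  have hle := numTurns_le (n := n) (r := r) (q := q) (turn n r k)
  generalize turn n r k = i at *
  subst hk'
  rcases lt_trichotomy t' t with h | rfl | h
  · exact (turnOf_lt_of_lt i i h (h.trans ht)).le
  · exact le_rfl
  · exfalso
    rcases (Nat.succ_le_of_lt h).eq_or_lt with h | h
    · obtain rfl : t + 1 = t' := h
      rcases hi with rfl | ⟨hi, htr⟩
      · omega
      · rw [turnOf_of_lt i htr, turnOf_of_lt i' htr] at hk
        have : (i' : ℕ) < i := hi
        omega
    · have := turnOf_lt_of_lt i' i (show t + 1 < t' from h) (show t + 1 < r by omega)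
      omega

theorem lt_of_picked_lt {n m : ℕ} [NeZero m] {σ : ℕ → Fin n} {u : Fin n → Fin m → ℝ} {i : Fin n}
    {k : ℕ} (hk : σ k = i) {a : ℝ} (h : u i (picked σ u k) < a) (c : Fin m)
    (hc : c ∈ remaining σ u k) : u i c < a := by
  have := le_picked σ u hc
  rw [hk] at this
  exact this.trans_lt h

section RoundRobin

variable {n r q : ℕ} [NeZero n] [NeZero (r * n + q)]

variable {α β : ℝ} {D : Measure ℝ} [IsProbabilityMeasure D]

/-- A low pick means that all available items are low; the exponent counts them. The condition `x p
≤ 1` keeps the previous value in the range where the lower density bound applies. -/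
theorem measureReal_pickOf_lt_prevValue_sub_le (hq : q < n) (hD : IsPDFBounded α β D)
    (hα : 0 < α) (i : Fin n) {t : ℕ} (ht : t < r) {d : ℝ} (hd : 0 ≤ d) (hd1 : d ≤ 1) :
    (Measure.pi (fun _ : Fin n × Fin (r * n + q) => D)).real
      {x | (∀ p, x p ≤ 1) ∧ Function.curry x i (pickOf r (Function.curry x) i t) <
        prevValue r (Function.curry x) i t - d} ≤
      (1 - α * d) ^ (r * n + q - turnOf n r i t) := by
  have hα1 := hD.le_one hα
  have hθ : 0 ≤ 1 - α * d := by nlinarith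
  refine measureReal_le_pow hθ ?_
  have hs : turnOf n r i t ≤ r * n + q := (turnOf_lt hq (ht.trans_le (le_numTurns i))).le
  rcases t with _ | t
  · refine (measure_mono fun x hx => ?_).trans
      (measure_forall_remaining_lt_le_of_first (turn n r) hs i ?_ (a := 1 - d) (by linarith)
        (measure_le_ofReal_mul (hD.measureReal_Iio_sub_le hα le_rfl hd hd1) hθ))
    · exact fun c hc => lt_of_picked_lt turn_turnOf hx.2 c hc
    · intro k hk hki
      subst hki
      obtain ⟨t', ht', hk'⟩ := exists_turnOf_eq hq (hk.trans_le hs)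
      rcases t' with _ | t'
      · omega
      · have := turnOf_lt_of_lt (turn n r k) (turn n r k) (show 0 < t' + 1 by omega) ht
        omega
  · refine (measure_mono fun x hx => ?_).trans
      (measure_forall_remaining_lt_le_of_last (turn n r) (p := turnOf n r i t) (i := i) hs
        (turnOf_lt_of_lt i i (Nat.lt_succ_self t) (by omega)) (fun k hk hki =>
        le_turnOf_of_turn_eq hq (by omega) (Or.inl rfl) hk (hk.trans_le hs) hki)
        (g := fun y => y - d) (by fun_prop) (Y := Set.Iic 1) measurableSet_Iic
        (fun y _ => by simpa using hd)
        fun y hy => measure_le_ofReal_mul (hD.measureReal_Iio_sub_le hα hy hd hd1) hθ)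
    exact ⟨hx.1 _, fun c hc => lt_of_picked_lt turn_turnOf hx.2 c hc⟩

theorem measureReal_last_pickOf_lt_le (hq : q < n) (hD : IsPDFBounded α β D)
    (hα : 0 < α) (hβ : 0 < β) {i : Fin n} (hi : n - q ≤ i) (hr : 1 ≤ r) {d : ℝ} (hd : 0 ≤ d)
    (hd1 : d ≤ 1 / 2) :
    (Measure.pi (fun _ : Fin n × Fin (r * n + q) => D)).real
      {x | 1 / 2 ≤ Function.curry x i (pickOf r (Function.curry x) i (r - 1)) ∧
        Function.curry x i (pickOf r (Function.curry x) i r) < d} ≤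
      (2 * β * d / α) ^ (i + 1 - (n - q)) := by
  have hθ : 0 ≤ 2 * β * d / α := by positivity
  have hN : (i : ℕ) + 1 - (n - q) = r * n + q - turnOf n r i r := by
    rw [turnOf_self]; omega
  rw [hN]
  refine measureReal_le_pow hθ ?_
  have hs : turnOf n r i r ≤ r * n + q :=
    (turnOf_lt hq (by unfold numTurns; rw [if_pos hi]; omega)).le
  refine (measure_mono fun x hx => ?_).trans
    (measure_forall_remaining_lt_le_of_last (turn n r) (p := turnOf n r i (r - 1)) (i := i) hs
      (turnOf_lt_of_lt i i (by omega) (by omega)) (fun k hk hki =>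
      le_turnOf_of_turn_eq hq (by omega) (Or.inl rfl) (by rwa [Nat.sub_add_cancel hr])
        (hk.trans_le hs) hki)
      (g := fun _ => d) measurable_const (Y := Set.Ici (1 / 2)) measurableSet_Ici
      (fun y hy => hd1.trans hy)
      fun y hy => measure_le_ofReal_mul (hD.measureReal_Iio_le_mul hα hβ hy hd) hθ)
  exact ⟨hx.1, fun c hc => lt_of_picked_lt turn_turnOf hx.2 c hc⟩

theorem measureReal_forall_lt_pickOf_le (hq : q < n) (hD : IsPDFBounded α β D) (hα : 0 < α)
    {i' i : Fin n} (hi : i' < i) {b h : ℕ} (hr : b + h < r) :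
    (Measure.pi (fun _ : Fin n × Fin (r * n + q) => D)).real
      {x | ∀ l < h, 1 / 4 < Function.curry x i (pickOf r (Function.curry x) i' (b + l + 1))} ≤
      (1 - α * (1 / 4)) ^ h := by
  have hα1 := hD.le_one hα
  have hθ : 0 ≤ 1 - α * (1 / 4) := by linarith
  have hn : 0 < n := by omega
  have hs : ∀ l < h, (b + l + 1) * n + i' = turnOf n r i' (b + l + 1) := fun l hl =>
    (turnOf_of_lt i' (by omega)).symm
  have hlt : ∀ l < h, turnOf n r i' (b + l + 1) < r * n + q := fun l hl =>
    turnOf_lt hq ((show b + l + 1 < r by omega).trans_le (le_numTurns i'))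
  refine measureReal_le_pow hθ ((measure_mono fun x hx => ?_).trans
    -- The explicit formula is strictly monotone on all of ℕ, whereas `turnOf` is constant from `r`
    -- on.
    (measure_forall_lt_picked_le (turn n r) (i := i) (s := fun l => (b + l + 1) * n + i')
      (p := fun l => turnOf n r i (b + l)) ?_ h ?_ ?_ (fun l _ => turn_turnOf) ?_ ?_ (a := 1 / 4)
      fun y => measure_le_ofReal_mul
        (hD.measureReal_Ioc_le hα (by norm_num) (by norm_num) y) hθ))
  · intro l hl
    simp only [hs l hl]
    exact hx l hl
  · refine strictMono_nat_of_lt_succ fun l => ?_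
    have : (b + (l + 1) + 1) * n = (b + l + 1) * n + n := by ring
    omega
  · intro l hl
    simp only [hs l hl]
    exact hlt l hl
  · intro l hl
    simp only [hs l hl]
    exact turnOf_lt_of_lt i i' (Nat.lt_succ_self _) (by omega)
  · intro l hl
    simp only [hs l hl]
    rw [turn_turnOf]
    exact hi.ne
  · intro l hl k hk hki
    simp only [hs l hl] at hk
    exact le_turnOf_of_turn_eq hq (by omega) (Or.inr ⟨hi, by omega⟩) hk (hk.trans (hlt l hl)) hki

/-! ### The failure probability -/

/-- If no agent suffers a large drop between two successive picks, the last picks in the reversed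
round are not too small, and (if there are many rounds) some items picked early by others have
small value for each agent, then the outcome is envy-free up to any item. -/
theorem isEFX_of_forall_prevValue_sub_le (hq : q < n) (u : Fin n → Fin (r * n + q) → ℝ)
    (h01 : ∀ i j, u i j ∈ Set.Icc 0 1) {δ : ℝ} (hδ : 0 < δ) (hδ1 : δ ≤ 1 / 4) {h : ℕ} (hh : 0 < h)
    (hgap : ∀ i, ∀ t < min (r - 1) (2 * h),
      prevValue r u i t - δ / (4 * h) ≤ u i (pickOf r u i t))
    (hgap' : 1 ≤ r → ∀ i, prevValue r u i (r - 1) - δ / 2 ≤ u i (pickOf r u i (r - 1)))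
    (hlast : 1 ≤ r → ∀ i : Fin n, n - q < i → 1 / 2 ≤ u i (pickOf r u i (r - 1)) →
      δ ≤ u i (pickOf r u i r))
    (hlow : 2 * h < r → ∀ i' i : Fin n, i' < i →
      (∃ l < h, u i (pickOf r u i' (0 + l + 1)) ≤ 1 / 4) ∧
      ∃ l < h, u i (pickOf r u i' (h + l + 1)) ≤ 1 / 4) :
    IsEFX u (roundRobinReversedLast u) := by
  have hh' : (0 : ℝ) < h := by exact_mod_cast hh
  have hstep : ∀ i, ∀ t ≤ min (r - 1) (2 * h), 1 - t * (δ / (4 * h)) ≤ prevValue r u i t := by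
    intro i t
    induction t with
    | zero => intro _; simp [prevValue]
    | succ t ih =>
      intro ht
      have h1 := ih (by omega)
      have h2 := hgap i t (by omega)
      have h3 : prevValue r u i (t + 1) = u i (pickOf r u i t) := rfl
      rw [h3]
      push_cast
      linarith
  -- At most `2 * h` drops of `δ / (4 * h)` use half of the budget δ; the other half is kept for the
  -- last regular round.
  have hprev : ∀ i, ∀ t ≤ min (r - 1) (2 * h), 1 - δ / 2 ≤ prevValue r u i t := by
    intro i t ht
    refine le_trans ?_ (hstep i t ht)
    have ht' : (t : ℝ) ≤ 2 * h := by exact_mod_cast ht.trans (min_le_right _ _)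
    have : (t : ℝ) * (δ / (4 * h)) ≤ 2 * h * (δ / (4 * h)) := by gcongr
    have h4 : 2 * h * (δ / (4 * h)) = δ / 2 := by field_simp; norm_num
    linarith
  refine isEFX_roundRobinReversedLast hq u (fun i j => (h01 i j).1) (fun i j => (h01 i j).2) ?_
  rcases le_or_gt r (2 * h) with hr | hr
  · have hA : 1 ≤ r → ∀ i, 1 - δ ≤ u i (pickOf r u i (r - 1)) := by
      intro hr1 i
      have h1 := hprev i (r - 1) (by omega)
      have h2 := hgap' hr1 i
      linarith
    refine Or.inl ⟨δ, by linarith, hA, fun hr1 i hi => hlast hr1 i hi ?_⟩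
    have := hA hr1 i
    linarith
  · refine Or.inr fun i' i hi => ?_
    have hy : ∀ t < 2 * h, 3 / 4 ≤ u i (pickOf r u i t) := by
      intro t ht
      have h1 : 1 - δ / 2 ≤ u i (pickOf r u i t) := hprev i (t + 1) (by omega)
      linarith
    obtain ⟨⟨l₁, hl₁, h1⟩, l₂, hl₂, h2⟩ := hlow hr i' i hi
    rw [zero_add] at h1
    have h3 := hy l₁ (by omega)
    have h4 := hy (h + l₂) (by omega)
    exact ⟨l₁, h + l₂, by omega, by omega, by linarith, by linarith⟩

/-- A union bound. The summands account for drops before the last regular round, a drop in that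
round, a small pick in the reversed round, and a block of picks of `i'` all worth more than 1/4 to
`i`. -/
theorem measureReal_not_isEFX_le (hq : q < n) (hD : IsPDFBounded α β D) (hα : 0 < α)
    (hβ : 0 < β) {δ : ℝ} (hδ : 0 < δ) (hδ1 : δ ≤ 1 / 4) (hδ2 : 2 * β * δ / α ≤ 1 / 2) {h : ℕ}
    (hh : 0 < h) :
    (Measure.pi (fun _ : Fin n × Fin (r * n + q) => D)).real
      {x | ¬ IsEFX (Function.curry x) (roundRobinReversedLast (Function.curry x))} ≤
      n * (2 * h) * (1 - α * (δ / (4 * h))) ^ n + (1 - α * (δ / 2)) ^ q / (α * (δ / 2)) +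
        2 * (2 * β * δ / α) ^ 2 + n * n * (2 * (1 - α * (1 / 4)) ^ h) := by
  have hα1 := hD.le_one hα
  have hh1 : (1 : ℝ) ≤ h := by exact_mod_cast hh
  have hd0 : 0 ≤ δ / (4 * h) := by positivity
  have hd1 : δ / (4 * h) ≤ 1 := by
    rw [div_le_one (by positivity)]
    linarith
  have hρ0 : 0 ≤ 1 - α * (δ / (4 * h)) := by nlinarith
  have hρ1 : 1 - α * (δ / (4 * h)) ≤ 1 := by nlinarith
  have hρ0' : 0 ≤ 1 - α * (δ / 2) := by nlinarith
  have hρ1' : 1 - α * (δ / 2) < 1 := by nlinarith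
  have hθ0 : 0 ≤ 1 - α * (1 / 4) := by linarith
  set π := Measure.pi (fun _ : Fin n × Fin (r * n + q) => D)
  let u : (Fin n × Fin (r * n + q) → ℝ) → Fin n → Fin (r * n + q) → ℝ := Function.curry
  let G : ℝ → Fin n → ℕ → Set (Fin n × Fin (r * n + q) → ℝ) := fun d i t =>
    {x | (∀ p, x p ≤ 1) ∧ u x i (pickOf r (u x) i t) < prevValue r (u x) i t - d}
  let Z : Set (Fin n × Fin (r * n + q) → ℝ) := {x | ¬ ∀ p, x p ∈ Set.Icc 0 1}
  let A : Set (Fin n × Fin (r * n + q) → ℝ) :=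
    ⋃ i ∈ (Finset.univ : Finset (Fin n)), ⋃ t ∈ Finset.range (min (r - 1) (2 * h)),
      G (δ / (4 * h)) i t
  let B : Set (Fin n × Fin (r * n + q) → ℝ) :=
    ⋃ i ∈ (Finset.univ : Finset (Fin n)), {x | 1 ≤ r ∧ x ∈ G (δ / 2) i (r - 1)}
  let L : Set (Fin n × Fin (r * n + q) → ℝ) :=
    ⋃ i ∈ Finset.univ.filter (fun i : Fin n => n - q < (i : ℕ)), {x | 1 ≤ r ∧
      1 / 2 ≤ u x i (pickOf r (u x) i (r - 1)) ∧ u x i (pickOf r (u x) i r) < δ}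
  let H : Fin n → Fin n → ℕ → Set (Fin n × Fin (r * n + q) → ℝ) := fun i' i b =>
    {x | (i' < i ∧ 2 * h < r) ∧ ∀ l < h, 1 / 4 < u x i (pickOf r (u x) i' (b + l + 1))}
  let E : Set (Fin n × Fin (r * n + q) → ℝ) :=
    ⋃ i' ∈ (Finset.univ : Finset (Fin n)), ⋃ i ∈ (Finset.univ : Finset (Fin n)),
      (H i' i 0 ∪ H i' i h)
  have hcover : {x | ¬ IsEFX (Function.curry x) (roundRobinReversedLast (Function.curry x))} ⊆
      Z ∪ (A ∪ B ∪ L ∪ E) := by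
    intro x hx
    by_contra hn
    simp only [Set.mem_union, not_or] at hn
    obtain ⟨hxZ, ⟨⟨hxA, hxB⟩, hxL⟩, hxE⟩ := hn
    have h01 : ∀ p, x p ∈ Set.Icc 0 1 := not_not.1 hxZ
    refine hx (isEFX_of_forall_prevValue_sub_le hq _ (fun i j => h01 (i, j)) hδ hδ1 hh
      ?_ ?_ ?_ ?_)
    · intro i t ht
      by_contra hlt
      exact hxA (Set.mem_iUnion₂.2 ⟨i, Finset.mem_univ i, Set.mem_iUnion₂.2
        ⟨t, Finset.mem_range.2 ht, fun p => (h01 p).2, not_le.1 hlt⟩⟩)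
    · intro hr i
      by_contra hlt
      exact hxB (Set.mem_iUnion₂.2 ⟨i, Finset.mem_univ i, hr, fun p => (h01 p).2, not_le.1 hlt⟩)
    · intro hr i hi hhalf
      by_contra hlt
      exact hxL (Set.mem_iUnion₂.2 ⟨i, Finset.mem_filter.2 ⟨Finset.mem_univ i, hi⟩, hr, hhalf,
        not_le.1 hlt⟩)
    · intro hr i' i hi
      have hxH : ¬ (x ∈ H i' i 0 ∨ x ∈ H i' i h) := fun hH =>
        hxE (Set.mem_iUnion₂.2 ⟨i', Finset.mem_univ i', Set.mem_iUnion₂.2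
          ⟨i, Finset.mem_univ i, hH⟩⟩)
      rw [not_or] at hxH
      constructor
      · by_contra hlt
        push Not at hlt
        exact hxH.1 ⟨⟨hi, hr⟩, hlt⟩
      · by_contra hlt
        push Not at hlt
        exact hxH.2 ⟨⟨hi, hr⟩, hlt⟩
  have hZ : π.real Z = 0 := by
    rw [measureReal_eq_zero_iff]
    have hsub : Z ⊆ ⋃ p, Function.eval p ⁻¹' (Set.Icc (0 : ℝ) 1)ᶜ := by
      intro x hx
      obtain ⟨p, hp⟩ := not_forall.1 (show ¬ ∀ p, x p ∈ Set.Icc 0 1 from hx)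
      exact Set.mem_iUnion.2 ⟨p, hp⟩
    refine measure_mono_null hsub (measure_iUnion_null fun p => ?_)
    rw [(measurePreserving_eval (fun _ : Fin n × Fin (r * n + q) => D) p).measure_preimage
      measurableSet_Icc.compl.nullMeasurableSet]
    exact hD.measure_compl_Icc
  have hA : π.real A ≤ n * (2 * h) * (1 - α * (δ / (4 * h))) ^ n := by
    have hG : ∀ i, ∀ t ∈ Finset.range (min (r - 1) (2 * h)),
        π.real (G (δ / (4 * h)) i t) ≤ (1 - α * (δ / (4 * h))) ^ n := by
      intro i t ht
      have ht : t < r - 1 := (Finset.mem_range.1 ht).trans_le (min_le_left _ _)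
      refine (measureReal_pickOf_lt_prevValue_sub_le hq hD hα i (by omega) hd0 hd1).trans
        (pow_le_pow_of_le_one hρ0 hρ1 ?_)
      -- As `t < r - 1`, another full regular round follows, so at least `n` items are available.
      rw [turnOf_of_lt i (by omega)]
      have : (t + 2) * n ≤ r * n := Nat.mul_le_mul_right n (by omega)
      have h2 : (t + 2) * n = t * n + 2 * n := by ring
      omega
    calc π.real A ≤ ∑ i, π.real (⋃ t ∈ Finset.range (min (r - 1) (2 * h)), G (δ / (4 * h)) i t) :=
          measureReal_biUnion_finset_le _ _
      _ ≤ ∑ _i : Fin n, (2 * h : ℝ) * (1 - α * (δ / (4 * h))) ^ n := by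
          refine Finset.sum_le_sum fun i _ => ?_
          refine (measureReal_biUnion_finset_le _ _).trans ((Finset.sum_le_sum (hG i)).trans ?_)
          rw [Finset.sum_const, Finset.card_range, nsmul_eq_mul]
          gcongr
          exact_mod_cast min_le_right _ _
      _ = _ := by
          rw [Finset.sum_const, Finset.card_univ, Fintype.card_fin, nsmul_eq_mul]
          ring
  have hB : π.real B ≤ (1 - α * (δ / 2)) ^ q / (α * (δ / 2)) := by
    -- Late agents see little more than `q` items here, so the larger drop `δ / 2` is allowed and
    -- the agents are summed geometrically.
    have hG : ∀ i, π.real {x | 1 ≤ r ∧ x ∈ G (δ / 2) i (r - 1)} ≤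
        (1 - α * (δ / 2)) ^ (n + q - i) := by
      intro i
      by_cases hr : 1 ≤ r
      · refine (measureReal_mono fun x hx => hx.2).trans
          ((measureReal_pickOf_lt_prevValue_sub_le hq hD hα i (t := r - 1) (by omega)
            (d := δ / 2) (by linarith) (by linarith)).trans_eq ?_)
        rw [turnOf_of_lt i (by omega)]
        congr 1
        have : (r - 1 + 1) * n = (r - 1) * n + n := by ring
        rw [Nat.sub_add_cancel hr] at this
        omega
      · simp [hr, hρ0']
    refine (measureReal_biUnion_finset_le _ _).trans ((Finset.sum_le_sum fun i _ => hG i).trans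
      ((sum_pow_add_sub_le hρ0' hρ1' n q).trans_eq ?_))
    rw [sub_sub_cancel]
  have hL : π.real L ≤ 2 * (2 * β * δ / α) ^ 2 := by
    have hθ : 0 ≤ 2 * β * δ / α := by positivity
    refine (measureReal_biUnion_finset_le _ _).trans ((Finset.sum_le_sum fun i hi => ?_).trans
      (sum_pow_sub_le hθ hδ2 n (n - q)))
    by_cases hr : 1 ≤ r
    · exact (measureReal_mono fun x hx => hx.2).trans (measureReal_last_pickOf_lt_le hq hD hα hβ
        (Finset.mem_filter.1 hi).2.le hr hδ.le (by linarith))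
    · simp only [hr, false_and, Set.ofPred_false, measureReal_empty]
      positivity
  have hE : π.real E ≤ n * n * (2 * (1 - α * (1 / 4)) ^ h) := by
    have hH : ∀ i' i b, b ≤ h → π.real (H i' i b) ≤ (1 - α * (1 / 4)) ^ h := by
      intro i' i b hb
      by_cases hi : i' < i ∧ 2 * h < r
      · exact (measureReal_mono fun x hx => hx.2).trans
          (measureReal_forall_lt_pickOf_le hq hD hα hi.1 (by omega))
      · have : H i' i b = ∅ := Set.eq_empty_of_forall_notMem fun x hx => hi hx.1
        rw [this, measureReal_empty]
        positivity
    calc π.real E ≤ ∑ i' : Fin n, ∑ i : Fin n, π.real (H i' i 0 ∪ H i' i h) :=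
          (measureReal_biUnion_finset_le _ _).trans
            (Finset.sum_le_sum fun i' _ => measureReal_biUnion_finset_le _ _)
      _ ≤ ∑ _i' : Fin n, ∑ _i : Fin n, 2 * (1 - α * (1 / 4)) ^ h := by
          refine Finset.sum_le_sum fun i' _ => Finset.sum_le_sum fun i _ => ?_
          have h1 := measureReal_union_le (μ := π) (H i' i 0) (H i' i h)
          have h2 := hH i' i 0 (by omega)
          have h3 := hH i' i h le_rfl
          linarith
      _ = _ := by simp [mul_assoc]
  have h1 := measureReal_mono (μ := π) hcover
  have h2 := measureReal_union_le (μ := π) Z (A ∪ B ∪ L ∪ E)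
  have h3 := measureReal_union_le (μ := π) (A ∪ B ∪ L) E
  have h4 := measureReal_union_le (μ := π) (A ∪ B) L
  have h5 := measureReal_union_le (μ := π) A B
  linarith

end RoundRobin

/-! ### Numerical estimates -/

theorem one_sub_pow_le_exp {a : ℝ} (ha : a ≤ 1) (n : ℕ) : (1 - a) ^ n ≤ Real.exp (-(n * a)) := by
  calc (1 - a) ^ n ≤ Real.exp (-a) ^ n :=
        pow_le_pow_left₀ (by linarith) (Real.one_sub_le_exp_neg a) n
    _ = Real.exp (-(n * a)) := by rw [← Real.exp_nat_mul]; ring_nf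

theorem exp_neg_le_div_pow {x : ℝ} (hx : 0 < x) (k : ℕ) :
    Real.exp (-x) ≤ (k.factorial : ℝ) / x ^ k := by
  have h := Real.pow_div_factorial_le_exp x hx.le k
  rw [Real.exp_neg, inv_le_comm₀ (Real.exp_pos x) (by positivity), inv_div]
  exact h

/-- Here `w = q^(1/4)`, `z = n^(1/4)` and `δ = w⁻¹`. The exponent is at least `α * z ^ 2 / 8`, and
the fourth term of the exponential series beats the prefactor of order `z ^ 5`; 393216 = 4 · 4! ·
8⁴. -/
theorem mul_one_sub_pow_le_div_sq {α w z : ℝ} {n h : ℕ} (hα : 0 < α) (hα1 : α ≤ 1) (hw : 1 ≤ w)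
    (hwz : w ≤ z) (hn : (n : ℝ) = z ^ 4) (hz : z ≤ h) (hh : (h : ℝ) ≤ 2 * z) :
    n * (2 * h) * (1 - α * (w⁻¹ / (4 * h))) ^ n ≤ 393216 / α ^ 4 / w ^ 2 := by
  have hz0 : 0 < z := by linarith
  have hw0 : 0 < w := by linarith
  have hh0 : (0 : ℝ) < h := by linarith
  have h1 : α * (w⁻¹ / (4 * h)) ≤ 1 := by
    have h2 : w⁻¹ ≤ 1 := inv_le_one_of_one_le₀ hw
    have h3 : w⁻¹ / (4 * h) ≤ 1 := by
      rw [div_le_one (by positivity)]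
      linarith
    calc α * (w⁻¹ / (4 * h)) ≤ 1 * 1 := by gcongr
      _ = 1 := one_mul 1
  have h2 : α * z ^ 2 / 8 ≤ n * (α * (w⁻¹ / (4 * h))) := by
    rw [hn, show z ^ 4 * (α * (w⁻¹ / (4 * h))) = α * z ^ 4 / (4 * (w * h)) by field_simp,
      div_le_div_iff₀ (by norm_num) (by positivity)]
    have : w * h ≤ z * (2 * z) := by gcongr
    calc α * z ^ 2 * (4 * (w * h)) ≤ α * z ^ 2 * (4 * (z * (2 * z))) := by gcongr
      _ = α * z ^ 4 * 8 := by ring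
  calc n * (2 * h) * (1 - α * (w⁻¹ / (4 * h))) ^ n
      ≤ z ^ 4 * (2 * (2 * z)) * ((Nat.factorial 4 : ℕ) / (α * z ^ 2 / 8) ^ 4) := by
        refine mul_le_mul ?_ ?_ (pow_nonneg (by linarith) _) (by positivity)
        · rw [hn]; gcongr
        · exact (one_sub_pow_le_exp h1 n).trans ((Real.exp_le_exp.2 (neg_le_neg h2)).trans
            (exp_neg_le_div_pow (by positivity) 4))
    _ = 393216 / α ^ 4 / z ^ 3 := by
        rw [show Nat.factorial 4 = 24 from rfl]; field_simp; norm_num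
    _ ≤ 393216 / α ^ 4 / w ^ 2 := by
        gcongr
        calc w ^ 2 ≤ z ^ 2 := by gcongr
          _ ≤ z ^ 3 := pow_le_pow_right₀ (by linarith) (by norm_num)

theorem one_sub_pow_div_le_div_sq {α w : ℝ} {q : ℕ} (hα : 0 < α) (hα1 : α ≤ 1) (hw : 1 ≤ w)
    (hq : (q : ℝ) = w ^ 4) :
    (1 - α * (w⁻¹ / 2)) ^ q / (α * (w⁻¹ / 2)) ≤ 4 / α ^ 2 / w ^ 2 := by
  have hw0 : 0 < w := by linarith
  have h1 : α * (w⁻¹ / 2) ≤ 1 := by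
    have h2 : w⁻¹ ≤ 1 := inv_le_one_of_one_le₀ hw
    calc α * (w⁻¹ / 2) ≤ 1 * 1 := by gcongr; linarith
      _ = 1 := one_mul 1
  have h2 : (q : ℝ) * (α * (w⁻¹ / 2)) = α * w ^ 3 / 2 := by rw [hq]; field_simp
  calc (1 - α * (w⁻¹ / 2)) ^ q / (α * (w⁻¹ / 2))
      ≤ (Nat.factorial 1 : ℕ) / (α * w ^ 3 / 2) ^ 1 / (α * (w⁻¹ / 2)) := by
        gcongr
        refine (one_sub_pow_le_exp h1 q).trans ?_
        rw [h2]
        exact exp_neg_le_div_pow (by positivity) 1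
    _ = 4 / α ^ 2 / w ^ 2 := by simp; field_simp; norm_num

/-- The tenth term of the exponential series turns the `n ^ 2 = z ^ 8` from the pairs of agents into
`z ^ (-2)`. -/
theorem sq_mul_one_sub_pow_le_div_sq {α w z : ℝ} {n h : ℕ} (hα : 0 < α) (hα1 : α ≤ 1)
    (hw : 1 ≤ w) (hwz : w ≤ z) (hn : (n : ℝ) = z ^ 4) (hz : z ≤ h) :
    n * n * (2 * (1 - α * (1 / 4)) ^ h) ≤
      2 * (Nat.factorial 10 : ℕ) * (4 / α) ^ 10 / w ^ 2 := by
  have hz0 : 0 < z := by linarith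
  have hw0 : 0 < w := by linarith
  calc n * n * (2 * (1 - α * (1 / 4)) ^ h)
      ≤ z ^ 4 * z ^ 4 * (2 * ((Nat.factorial 10 : ℕ) / (α * z / 4) ^ 10)) := by
        rw [hn]
        gcongr
        refine (one_sub_pow_le_exp (by linarith) h).trans
          ((Real.exp_le_exp.2 (neg_le_neg ?_)).trans (exp_neg_le_div_pow (by positivity) 10))
        calc α * z / 4 = z * (α * (1 / 4)) := by ring
          _ ≤ h * (α * (1 / 4)) := by gcongr
    _ = 2 * (Nat.factorial 10 : ℕ) * (4 / α) ^ 10 / z ^ 2 := by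
        field_simp
    _ ≤ _ := by gcongr

theorem measureReal_not_isEFX_le_div_sqrt {α β : ℝ} (hα : 0 < α) (hβ : 0 < β) {D : Measure ℝ}
    [IsProbabilityMeasure D] (hD : IsPDFBounded α β D) {n r q : ℕ} [NeZero n]
    [NeZero (r * n + q)] (hq : q < n) (hq1 : 1 ≤ q) :
    (Measure.pi (fun _ : Fin n × Fin (r * n + q) => D)).real
      {x | ¬ IsEFX (Function.curry x) (roundRobinReversedLast (Function.curry x))} ≤
      (16 + 16 * β ^ 2 / α ^ 2 + 393216 / α ^ 4 + 4 / α ^ 2 + 8 * β ^ 2 / α ^ 2 +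
        2 * (Nat.factorial 10 : ℕ) * (4 / α) ^ 10) / √(q : ℝ) := by
  have hα1 := hD.le_one hα
  obtain ⟨w, hw1, hwq⟩ : ∃ w : ℝ, 1 ≤ w ∧ √(q : ℝ) = w ^ 2 := by
    refine ⟨√√(q : ℝ), ?_, (Real.sq_sqrt (Real.sqrt_nonneg _)).symm⟩
    exact Real.one_le_sqrt.2 (Real.one_le_sqrt.2 (by exact_mod_cast hq1))
  have hw0 : 0 < w := by linarith
  have hqw : (q : ℝ) = w ^ 4 := by
    rw [← Real.sq_sqrt (Nat.cast_nonneg q), hwq]; ring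
  obtain ⟨z, hwz, hnz⟩ : ∃ z : ℝ, w ≤ z ∧ (n : ℝ) = z ^ 4 := by
    refine ⟨√√(n : ℝ), ?_, ?_⟩
    · refine Real.le_sqrt_of_sq_le ?_
      rw [← hwq]
      exact Real.sqrt_le_sqrt (by exact_mod_cast hq.le)
    · rw [show √√(n : ℝ) ^ 4 = (√√(n : ℝ) ^ 2) ^ 2 by ring, Real.sq_sqrt (Real.sqrt_nonneg _),
        Real.sq_sqrt (Nat.cast_nonneg n)]
  rw [hwq]
  -- These are exactly `δ ≤ 1 / 4` and `2 * β * δ / α ≤ 1 / 2`. Otherwise `w ^ 2` is at most the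
  -- first two summands of the constant, and the bound exceeds 1.
  by_cases hbig : 4 ≤ w ∧ 4 * β / α ≤ w
  · obtain ⟨hw4, hwβ⟩ := hbig
    have hz := Nat.le_ceil z
    have hh : (⌈z⌉₊ : ℝ) ≤ 2 * z := by
      have := Nat.ceil_lt_add_one (show 0 ≤ z by linarith)
      linarith
    have hδ2 : 2 * β * w⁻¹ / α ≤ 1 / 2 := by
      have h1 : 4 * β ≤ w * α := (div_le_iff₀ hα).1 hwβ
      rw [show 2 * β * w⁻¹ / α = 2 * β / (w * α) by field_simp, div_le_iff₀ (by positivity)]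
      linarith
    have hδ1 : w⁻¹ ≤ 1 / 4 := by
      rw [one_div]
      exact inv_anti₀ (by norm_num) hw4
    have h0 := measureReal_not_isEFX_le (r := r) hq hD hα hβ (inv_pos.2 hw0) hδ1 hδ2
      (h := ⌈z⌉₊) (Nat.ceil_pos.2 (by linarith))
    have h1 := mul_one_sub_pow_le_div_sq hα hα1 hw1 hwz hnz hz hh
    have h2 := one_sub_pow_div_le_div_sq hα hα1 hw1 hqw
    have h3 := sq_mul_one_sub_pow_le_div_sq hα hα1 hw1 hwz hnz hz
    have h4 : 2 * (2 * β * w⁻¹ / α) ^ 2 = 8 * β ^ 2 / α ^ 2 / w ^ 2 := by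
      field_simp; norm_num
    have h5 : 0 ≤ (16 + 16 * β ^ 2 / α ^ 2) / w ^ 2 := by positivity
    simp only [add_div] at h5 ⊢
    linarith
  · refine measureReal_le_one.trans ?_
    rw [one_le_div (by positivity)]
    have h1 : w ^ 2 ≤ 16 + 16 * β ^ 2 / α ^ 2 := by
      rw [not_and_or, not_le, not_le] at hbig
      rcases hbig with h | h
      · have : 0 ≤ 16 * β ^ 2 / α ^ 2 := by positivity
        nlinarith
      · have : w ^ 2 ≤ (4 * β / α) ^ 2 := by gcongr
        have h2 : (4 * β / α) ^ 2 = 16 * β ^ 2 / α ^ 2 := by ring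
        linarith
    have h2 : 0 ≤ 393216 / α ^ 4 + 4 / α ^ 2 + 8 * β ^ 2 / α ^ 2 +
        2 * (Nat.factorial 10 : ℕ) * (4 / α) ^ 10 := by positivity
    linarith

/-! ### From the product measure to independent utilities -/

theorem theorem5p2 (α β : ℝ) (hα : 0 < α) (hβ : 0 < β) :
    ∃ C : ℝ, 0 < C ∧
      ∀ (D : Measure ℝ) [IsProbabilityMeasure D], IsPDFBounded α β D →
      ∀ (n m r q : ℕ), m = r * n + q → q < n → 1 ≤ q →
      ∀ {Ω : Type*} [MeasurableSpace Ω] (P : Measure Ω) [IsProbabilityMeasure P]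
        (U : Fin n → Fin m → Ω → ℝ),
        (∀ i j, Measurable (U i j)) →
        (∀ i j, P.map (U i j) = D) →
        iIndepFun (fun (p : Fin n × Fin m) => U p.1 p.2) P →
        1 - C / √(q : ℝ) ≤
          P.real {ω | IsAllocation (roundRobinReversedLast (fun i j => U i j ω)) ∧
            IsEFX (fun i j => U i j ω) (roundRobinReversedLast (fun i j => U i j ω))} := by
  refine ⟨16 + 16 * β ^ 2 / α ^ 2 + 393216 / α ^ 4 + 4 / α ^ 2 + 8 * β ^ 2 / α ^ 2 +
    2 * (Nat.factorial 10 : ℕ) * (4 / α) ^ 10, by positivity,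
    fun D _ hD n m r q hm hq hq1 Ω _ P _ U hU hUD hind => ?_⟩
  subst hm
  have : NeZero n := ⟨by omega⟩
  have : NeZero (r * n + q) := ⟨by omega⟩
  have hbound := measureReal_not_isEFX_le_div_sqrt hα hβ hD (r := r) hq hq1
  let X : Ω → Fin n × Fin (r * n + q) → ℝ := fun ω p => U p.1 p.2 ω
  have hX : Measurable X := measurable_pi_lambda _ fun p : Fin n × Fin (r * n + q) => hU p.1 p.2
  have hmap : P.map X = Measure.pi fun _ => D := by
    have := (iIndepFun_iff_map_fun_eq_pi_map
      fun p : Fin n × Fin (r * n + q) => (hU p.1 p.2).aemeasurable).1 hind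
    simp only [hUD] at this
    exact this
  have hbad : P.real {ω | ¬ IsEFX (fun i j => U i j ω)
      (roundRobinReversedLast (fun i j => U i j ω))} ≤
      (Measure.pi (fun _ : Fin n × Fin (r * n + q) => D)).real
        {x | ¬ IsEFX (Function.curry x) (roundRobinReversedLast (Function.curry x))} := by
    rw [← hmap]
    have : IsProbabilityMeasure (P.map X) := Measure.isProbabilityMeasure_map hX.aemeasurable
    -- This inequality holds for arbitrary sets, so measurability of the EFX event is not needed;
    -- below, subadditivity replaces complements for the same reason.
    exact ENNReal.toReal_mono (measure_ne_top _ _) (Measure.le_map_apply hX.aemeasurable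
      {x | ¬ IsEFX (Function.curry x) (roundRobinReversedLast (Function.curry x))})
  have hone : 1 ≤ P.real {ω | ¬ IsEFX (fun i j => U i j ω)
        (roundRobinReversedLast (fun i j => U i j ω))} +
      P.real {ω | IsAllocation (roundRobinReversedLast (fun i j => U i j ω)) ∧
        IsEFX (fun i j => U i j ω) (roundRobinReversedLast (fun i j => U i j ω))} := by
    rw [← probReal_univ (μ := P)]
    refine (measureReal_mono fun ω _ => ?_).trans (measureReal_union_le _ _)
    rw [Set.mem_union]
    by_cases h : IsEFX (fun i j => U i j ω) (roundRobinReversedLast (fun i j => U i j ω))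
    · exact Or.inr ⟨isAllocation_roundRobinReversedLast hq _, h⟩
    · exact Or.inl h
  linarith
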